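/- Let $d\ge 1$. Let $\mathcal{E}=\ell^2(\mathbb{Z}^d;\mathbb{C})\times\ell^2(\mathbb{Z}^d;\mathbb{C})$ be the complexified phase space of points $z=(u,v)$ with $\|z\|^2=\sum_j(|u_j|^2+|v_j|^2)$ and symplectic form $\sum_j(u_jv'_j-v_ju'_j)$, and for $0<R<1$ and $\mathfrak{d}\ge 0$ put $B_{R,\mathfrak{d}}=\{z\in\mathcal{E}:\|z\|<R(1-\mathfrak{d})\}$. For a holomorphic function $g$ let $X_g=(\partial_v g,-\partial_u g)$ be its Hamiltonian vector field, and let $N_{\mathfrak{d}}(g)=\sup_{B_{R,\mathfrak{d}}}|g|$ and $N^{\nabla}_{\mathfrak{d}}(g)=\frac1R\sup_{B_{R,\mathfrak{d}}}\|X_g\|$. For an integer $p\ge1$ and $\epsilon>0$ consider the scaled discrete Klein--Gordon Hamiltonian $H=G+F$, $$G=\frac12\sum_{j\in\mathbb{Z}^d}(u_j^2+v_j^2),\qquad F=\frac{\epsilon}{2p+2}\sum_{j\in\mathbb{Z}^d}u_j^{2p+2}+\frac{\epsilon}{2}\sum_{j\in\mathbb{Z}^d}\sum_{|j-h|=1}(u_j-u_h)^2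 .$$ There is a constant $C_d>0$ depending only on $d$ such that for all $0<\mathfrak{d}\le\frac14$ and $0<R<1$ there exist $\epsilon^*>0$ and $C>0$, depending only on $\mathfrak{d},d,R$, such that for every integer $p\ge 1$ and every $0<\epsilon<\epsilon^*$, with $$\omega_1=2\epsilon\,(C_d+R^{2p}),\qquad \mu=\frac{12e\pi\,\omega_1}{\mathfrak{d}}=\mathcal{O}(\epsilon),$$ the following holds. There are a canonical change of coordinates $T$ on $B_{R,\mathfrak{d}}$ (biholomorphic onto its open image, symplectic, mapping real points to real points) with $\|T(z)-z\|\le C\mu R$ on $B_{R,\mathfrak{d}}$ and $$B_{R,2\mathfrak{d}}\subset T(B_{R,\mathfrak{d}})\subset B_{R,0},\qquad B_{R,3\mathfrak{d}}\subset T(B_{R,2\mathfrak{d}})\subset B_{R,\mathfrak{d}},$$ and holomorphic functions $Z,\mathcal{P}$ on $B_{R,\mathfrak{d}}$, with $Z$ real at real points, such that on $B_{R,\mathfrak{d}}$ $$H\circ T=G+Z+\mathcal{P},\qquad \{G,Z\}=0,\qquad N^{\nabla}_{\mathfrak{d}}(\mathcal{P})\le\mu\exp\left(-\frac1\mu\right).$$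 Moreover, for every real initial datum $z_0\in B_{R,3\mathfrak{d}}$ the Hamilton equations $\dot z=X_H(z)$, $z(0)=z_0$, have a solution on $|t|\le\exp(1/\mu)$, and every such solution satisfies, for all $|t|\le \exp(1/\mu)$, $z(t)\in B_{R,\mathfrak{d}}$ and $$|G(z(t))-G(z_0)|<C\mu N_0(G),\qquad |Z(z(t))-Z(z_0)|<C\mu N_0(F).$$ -/

import Mathlib

open Set

noncomputable section

namespace KleinGordon

/-- Complex `ℓ²(ℤ^d)`. -/
abbrev Seq (d : ℕ) : Type := lp (fun _ : Fin d → ℤ => ℂ) 2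

/-- The complexified phase space `ℓ²(ℤ^d; ℂ) × ℓ²(ℤ^d; ℂ)` of points `z = (u, v)`,
with the Hilbert norm `‖z‖² = ∑ |u_j|² + |v_j|²`. -/
abbrev Phase (d : ℕ) : Type := WithLp 2 (Seq d × Seq d)

variable {d : ℕ}

/-- The position coordinate `u_j`. -/
def posCoord (z : Phase d) (j : Fin d → ℤ) : ℂ := z.fst j

/-- The momentum coordinate `v_j`. -/
def momCoord (z : Phase d) (j : Fin d → ℤ) : ℂ := z.snd j

/-- Points of the real phase space. -/
def IsReal (z : Phase d) : Prop := ∀ j, (posCoord z j).im = 0 ∧ (momCoord z j).im = 0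

/-- The ball `B_{R,δ}`: `‖z‖ < R (1 - δ)`. -/
def ballRd (d : ℕ) (R δ : ℝ) : Set (Phase d) := Metric.ball 0 (R * (1 - δ))

/-- The `i`-th lattice unit vector. -/
def unitVec (i : Fin d) : Fin d → ℤ := Pi.single i 1

/-- `G = ½ ∑_j (u_j² + v_j²)`. -/
def G (z : Phase d) : ℂ := 1 / 2 * ∑' j, (posCoord z j ^ 2 + momCoord z j ^ 2)

/-- `F = ε/(2p+2) ∑_j u_j^{2p+2} + ε/2 ∑_j ∑_{|j-h|=1} (u_j - u_h)²`; the `2d` neighbours `h`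
of `j` are the points `j ± e_i`. -/
def F (p : ℕ) (ε : ℝ) (z : Phase d) : ℂ :=
  (ε : ℂ) / (2 * (p : ℂ) + 2) * ∑' j, posCoord z j ^ (2 * p + 2) +
    (ε : ℂ) / 2 * ∑' j, ∑ i : Fin d,
      ((posCoord z j - posCoord z (j + unitVec i)) ^ 2 +
        (posCoord z j - posCoord z (j - unitVec i)) ^ 2)

/-- The scaled discrete Klein-Gordon Hamiltonian `H = G + F`. -/
def H (p : ℕ) (ε : ℝ) (z : Phase d) : ℂ := G z + F p ε z

/-- The Hamiltonian vector field `X_f = (∂f/∂v, -∂f/∂u)` of a holomorphic function `f`.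
The Riesz vector `w` of the differential satisfies `df(h) = ∑ conj(w_j) h_j`, so the vector of
partial derivatives of `f` is the complex conjugate of `w`. -/
def hamField (f : Phase d → ℂ) (z : Phase d) : Phase d :=
  let w : Phase d := (InnerProductSpace.toDual ℂ (Phase d)).symm (fderiv ℂ f z)
  WithLp.toLp 2 (star w.snd, -star w.fst)

/-- The Poisson bracket `{f, g} = ∑_j (∂f/∂u_j ∂g/∂v_j - ∂f/∂v_j ∂g/∂u_j) = df(X_g)`. -/
def poisson (f g : Phase d → ℂ) (z : Phase d) : ℂ := fderiv ℂ f z (hamField g z)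

/-- The (complex bilinear) symplectic form `∑_j (u_j v'_j - v_j u'_j)`. -/
def sympl (z w : Phase d) : ℂ :=
  ∑' j, (posCoord z j * momCoord w j - momCoord z j * posCoord w j)

/-- `T` is a canonical change of coordinates on the open set `U`: a biholomorphic map of `U` onto
an open set, preserving the symplectic form and mapping real points to real points. -/
structure IsCanonical (T : Phase d → Phase d) (U : Set (Phase d)) : Prop where
  holo : DifferentiableOn ℂ T U
  isOpen_image : IsOpen (T '' U)
  inverse : ∃ S : Phase d → Phase d, DifferentiableOn ℂ S (T '' U) ∧ LeftInvOn S T U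
  symplectic : ∀ z ∈ U, ∀ h k : Phase d, sympl (fderiv ℂ T z h) (fderiv ℂ T z k) = sympl h k
  real : ∀ z ∈ U, IsReal z → IsReal (T z)

/-- `N_δ(g) = sup_{B_{R,δ}} |g|`. -/
def supNorm (R δ : ℝ) (g : Phase d → ℂ) : ENNReal := ⨆ z ∈ ballRd d R δ, ‖g z‖ₑ

/-- `N^∇_δ(g) = R⁻¹ sup_{B_{R,δ}} ‖X_g‖`. -/
def fieldNorm (R δ : ℝ) (g : Phase d → ℂ) : ENNReal :=
  (ENNReal.ofReal R)⁻¹ * ⨆ z ∈ ballRd d R δ, ‖hamField g z‖ₑ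

/-- `z` solves Hamilton's equations `ż = X_f(z)` on the time interval `[-τ, τ]`, with
`z(0) = z₀`. -/
def IsOrbit (f : Phase d → ℂ) (τ : ℝ) (z₀ : Phase d) (z : ℝ → Phase d) : Prop :=
  z 0 = z₀ ∧ ∀ t ∈ Icc (-τ) τ, HasDerivWithinAt z (hamField f (z t)) (Icc (-τ) τ) t

/-- The small parameter `μ = 12 e π ω₁ / δ`, where `ω₁ = 2 ε (c + R^{2p})`. -/
def mu (c R δ : ℝ) (p : ℕ) (ε : ℝ) : ℝ :=
  12 * Real.exp 1 * Real.pi * (2 * ε * (c + R ^ (2 * p))) / δ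

end KleinGordon

end

/-! The flow of `G` rotates every oscillator with the same period `2π` and is isometric on the
complexified space. Near-resonances, and hence small divisors, are therefore absent: averaging a
perturbation over one period splits off the part commuting with `G`. The whole argument takes place
in an abstract `OscillatorSpace`, and the size of a function is measured by the norm of its
gradient.

One averaging step (`exists_averaging_step`) replaces a remainder `P` by its mean `Q` over the flow
plus a smaller error. The generator `χ` is the average of `P` with weight `s - π`; integration by
parts (`fderiv_avg_A`) gives `dχ(A z) = P z - Q z`. The canonical map is the implicit midpoint map
of `χ` instead of its time-one flow: `z = m - X(m)/2` is sent to `m + X(m)/2`. It is symplectic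
because `DX` is skew for `ω`, and since the energy is quadratic its increment is exactly `ω(A m, X
m) = Q m - P m`. The homological equation is thus solved without a Taylor remainder of the energy.
The errors left are increments of `Q`, `P` and `Z` over distances of order `a`, and Cauchy's
estimate turns their bound into a gradient bound.

The gradient of `F` on the ball of radius `R` is at most `κR` with `κ = ε(8d+1)`. Each step costs a
fixed radius `128κR` and divides the gradient of the remainder by 4 (`exists_normal_form`). About
`δ/(256κ)` steps fit into the radius `δR/2`, which makes the remainder exponentially small
(`exists_step_number`).

For stability, the energy and `Z` in the new coordinates change along an orbit only through `P`
(`fderiv_energy_pullback_field`, `fderiv_Z_pullback_field`), so they hardly move during the time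
`exp(1/μ)`. At real points the energy is half the squared norm, so its near conservation confines
the orbit: a continuity argument (`forall_le_of_bootstrap`) closes the estimate in `stability`.
Existence comes from a globally Lipschitz cutoff field, whose solutions obey the same estimate and
never leave the region where the cutoff equals 1 (`exists_orbit`). Lower bounds for the sup norms of
`G` and `F`, obtained from a single excited site, put the errors into the stated form. -/

noncomputable section

/-! ### Cauchy estimates and holomorphy of the derivative in Banach spaces -/

namespace HolomorphicNormalForm

open Metric Filter Topology

section Banach

variable {E F : Type*} [NormedAddCommGroup E] [NormedSpace ℂ E] [NormedAddCommGroup F]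
  [NormedSpace ℂ F]

theorem norm_fderiv_le_of_bounded {f : E → F} {c : E} {r M : ℝ} (hr : 0 < r)
    (hf : DifferentiableOn ℂ f (ball c r)) (hM : ∀ z ∈ ball c r, ‖f z‖ ≤ M) :
    ‖fderiv ℂ f c‖ ≤ 2 * M / r := by
  refine Complex.norm_fderiv_le_div_of_mapsTo_ball hf (fun z hz => ?_) hr
  rw [mem_closedBall_iff_norm]
  linarith [norm_sub_le (f z) (f c), hM z hz, hM c (mem_ball_self hr)]

/-- Cauchy's estimate on a smaller concentric ball. -/
theorem norm_fderiv_le_of_bounded_ball {f : E → F} {c z : E} {r s M : ℝ} (hs : 0 < s)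
    (hf : DifferentiableOn ℂ f (ball c r)) (hM : ∀ z ∈ ball c r, ‖f z‖ ≤ M)
    (hz : z ∈ ball c (r - s)) : ‖fderiv ℂ f z‖ ≤ 2 * M / s := by
  have hsub : ball z s ⊆ ball c r := ball_subset_ball' (by rw [mem_ball] at hz; linarith)
  exact norm_fderiv_le_of_bounded hs (hf.mono hsub) fun w hw => hM w (hsub hw)

/-- Second order Taylor estimate for a bounded holomorphic function. -/
theorem norm_sub_sub_fderiv_le {f : E → F} {c z : E} {r M : ℝ}
    (hf : DifferentiableOn ℂ f (ball c r)) (hM : ∀ z ∈ ball c r, ‖f z‖ ≤ M)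
    (hz : z ∈ ball c r) :
    ‖f z - f c - fderiv ℂ f c (z - c)‖ ≤ 4 * M * (‖z - c‖ / r) ^ 2 := by
  have hr : 0 < r := nonempty_ball.1 ⟨z, hz⟩
  have hc : c ∈ ball c r := mem_ball_self hr
  have hfc : DifferentiableAt ℂ f c := hf.differentiableAt (isOpen_ball.mem_nhds hc)
  have hd := norm_fderiv_le_of_bounded hr hf hM
  have key := Complex.dist_le_mul_div_pow_of_mapsTo_ball_of_isLittleO
    (f := fun w => f w - fderiv ℂ f c (w - c)) (c := c) (z := z) (R₁ := r) (R₂ := 4 * M) (n := 1)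
    (hf.sub (by fun_prop)) (fun w hw => ?_) ?_ hz
  · simp only [sub_self, map_zero, sub_zero, dist_eq_norm] at key
    rwa [sub_right_comm] at key
  · rw [mem_closedBall_iff_norm]
    simp only [sub_self, map_zero, sub_zero]
    have h1 : ‖fderiv ℂ f c (w - c)‖ ≤ 2 * M := by
      refine ((fderiv ℂ f c).le_opNorm _).trans ?_
      calc _ ≤ 2 * M / r * r := by
            have : ‖w - c‖ ≤ r := (mem_ball_iff_norm.1 hw).le
            gcongr
            exact (norm_nonneg _).trans hd
        _ = 2 * M := by field_simp
    have h2 := norm_sub_le (f w) (fderiv ℂ f c (w - c))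
    have h3 := norm_sub_le (f w - fderiv ℂ f c (w - c)) (f c)
    linarith [hM w hw, hM c hc]
  · have := hfc.hasFDerivAt.isLittleO
    simp only [sub_self, map_zero, sub_zero, pow_one]
    refine (this.congr_left fun w => ?_).norm_right
    abel

/-- A uniform limit of holomorphic maps on a ball is differentiable at the centre. -/
theorem differentiableAt_of_tendstoUniformlyOn [CompleteSpace F] {f : ℕ → E → F} {g : E → F}
    {c : E} {r : ℝ} (hr : 0 < r) (hf : ∀ n, DifferentiableOn ℂ (f n) (ball c r))
    (hfg : TendstoUniformlyOn f g atTop (ball c r)) : DifferentiableAt ℂ g c := by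
  have hsub : ball c (r / 2) ⊆ ball c r := ball_subset_ball (by linarith)
  have hC : UniformCauchySeqOn (fun n => fderiv ℂ (f n)) atTop (ball c (r / 2)) := by
    rw [Metric.uniformCauchySeqOn_iff]
    intro ε hε
    -- Cauchy's estimate with radius `r / 2` turns a gap `ε * r / 8` between functions into a gap `ε
    -- / 2` between derivatives.
    obtain ⟨N, hN⟩ := Metric.uniformCauchySeqOn_iff.1 hfg.uniformCauchySeqOn (ε * r / 8)
      (by positivity)
    refine ⟨N, fun m hm n hn z hz => ?_⟩
    have hz' : z ∈ ball c (r - r / 2) := by convert hz using 2; ring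
    have hd : ∀ k, DifferentiableAt ℂ (f k) z := fun k =>
      (hf k).differentiableAt (isOpen_ball.mem_nhds (hsub hz))
    have := norm_fderiv_le_of_bounded_ball (half_pos hr) ((hf m).sub (hf n))
      (M := ε * r / 8) (fun w hw => by
        have := (hN m hm n hn w hw).le
        rwa [dist_eq_norm] at this) hz'
    rw [fderiv_sub (hd m) (hd n)] at this
    rw [dist_eq_norm]
    refine this.trans_lt ?_
    have : 2 * (ε * r / 8) / (r / 2) = ε / 2 := by field_simp; norm_num
    rw [this]; linarith
  have hlim : ∀ z ∈ ball c (r / 2), ∃ L, Tendsto (fun n => fderiv ℂ (f n) z) atTop (𝓝 L) :=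
    fun z hz => cauchySeq_tendsto_of_complete (hC.cauchySeq hz)
  choose! g' hg' using hlim
  have hu := hC.tendstoUniformlyOn_of_tendsto hg'
  exact (hasFDerivAt_of_tendstoUniformlyOn isOpen_ball hu
    (fun n z hz => ((hf n).differentiableAt (isOpen_ball.mem_nhds (hsub hz))).hasFDerivAt)
    (fun z hz => hfg.tendsto_at (hsub hz)) (mem_ball_self (half_pos hr))).differentiableAt

/-- The directional derivative is the limit of difference quotients, and the second order Taylor
estimate makes this limit locally uniform in the base point; uniform limits of holomorphic maps are
holomorphic. -/
theorem differentiableAt_fderiv_apply [CompleteSpace F] {f : E → F} {c : E} {r M : ℝ}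
    (hf : DifferentiableOn ℂ f (ball c r)) (hM : ∀ z ∈ ball c r, ‖f z‖ ≤ M) {z : E}
    (hz : z ∈ ball c r) (h : E) : DifferentiableAt ℂ (fun w => fderiv ℂ f w h) z := by
  obtain ⟨s, hs, hsub⟩ := Metric.isOpen_iff.1 isOpen_ball z hz
  have hr : 0 < r := nonempty_ball.1 ⟨z, hz⟩
  have hM0 : 0 ≤ M := (norm_nonneg _).trans (hM z hz)
  -- The shift by `N` keeps all increments `h / (N + n)` shorter than `s / 2`, the first one
  -- included.
  obtain ⟨N, hN⟩ := exists_nat_gt (2 * ‖h‖ / s)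
  have hN0 : (0 : ℝ) < N := lt_of_le_of_lt (by positivity) hN
  have hstep : ∀ n : ℕ, ‖((N + n : ℝ) : ℂ)⁻¹ • h‖ < s / 2 := fun n => by
    have hNn : (0 : ℝ) < N + n := by positivity
    rw [norm_smul, norm_inv, Complex.norm_real, Real.norm_of_nonneg hNn.le, inv_mul_lt_iff₀ hNn]
    rw [div_lt_iff₀ hs] at hN
    nlinarith [(Nat.cast_nonneg n : (0 : ℝ) ≤ n)]
  have hin : ∀ w ∈ ball z (s / 2), ∀ n : ℕ, w + ((N + n : ℝ) : ℂ)⁻¹ • h ∈ ball w (s / 2) :=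
    fun w hw n => by simpa [mem_ball_iff_norm] using hstep n
  have hball : ∀ w ∈ ball z (s / 2), ball w (s / 2) ⊆ ball c r := fun w hw =>
    (ball_subset_ball' (by rw [mem_ball] at hw; linarith)).trans hsub
  refine differentiableAt_of_tendstoUniformlyOn (r := s / 2) (half_pos hs)
    (f := fun n w => ((N + n : ℝ) : ℂ) • (f (w + ((N + n : ℝ) : ℂ)⁻¹ • h) - f w)) (fun n => ?_) ?_
  · refine DifferentiableOn.const_smul (DifferentiableOn.sub ?_ ?_) _
    · refine hf.comp (by fun_prop) fun w hw => hball w hw (hin w hw n)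
    · exact hf.mono fun w hw => hball w hw (mem_ball_self (half_pos hs))
  · rw [Metric.tendstoUniformlyOn_iff]
    intro ε hε
    obtain ⟨K, hK⟩ := exists_nat_gt (4 * M * (‖h‖ / (s / 2)) ^ 2 / ε)
    filter_upwards [eventually_ge_atTop K] with n hn w hw
    have hNn : (0 : ℝ) < N + n := by positivity
    have hne : ((N + n : ℝ) : ℂ) ≠ 0 := by exact_mod_cast hNn.ne'
    have hT := norm_sub_sub_fderiv_le (hf.mono (hball w hw))
      (fun y hy => hM y (hball w hw hy)) (hin w hw n)
    rw [add_sub_cancel_left, map_smul, norm_smul, norm_inv, Complex.norm_real,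
      Real.norm_of_nonneg hNn.le] at hT
    rw [dist_comm, dist_eq_norm]
    have heq : ((N + n : ℝ) : ℂ) • (f (w + ((N + n : ℝ) : ℂ)⁻¹ • h) - f w) - fderiv ℂ f w h
        = ((N + n : ℝ) : ℂ) • (f (w + ((N + n : ℝ) : ℂ)⁻¹ • h) - f w
          - ((N + n : ℝ) : ℂ)⁻¹ • fderiv ℂ f w h) := by
      rw [smul_sub _ (f _ - f _), smul_inv_smul₀ hne]
    rw [heq, norm_smul, Complex.norm_real, Real.norm_of_nonneg hNn.le]
    calc _ ≤ (N + n) * (4 * M * ((N + n : ℝ)⁻¹ * ‖h‖ / (s / 2)) ^ 2) := by gcongr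
      _ = (4 * M * (‖h‖ / (s / 2)) ^ 2) / (N + n) := by field_simp
      _ < ε := by
        rw [div_lt_iff₀ hNn]
        rw [div_lt_iff₀ hε] at hK
        have : (K : ℝ) ≤ n := by exact_mod_cast hn
        nlinarith

/-- The derivative of a holomorphic map between Banach spaces is holomorphic. -/
theorem differentiableOn_fderiv [CompleteSpace F] {f : E → F} {U : Set E} (hU : IsOpen U)
    (hf : DifferentiableOn ℂ f U) : DifferentiableOn ℂ (fderiv ℂ f) U := by
  intro c hc
  refine DifferentiableAt.differentiableWithinAt ?_
  obtain ⟨r, hr, hrU, M, hM⟩ : ∃ r > 0, ball c r ⊆ U ∧ ∃ M, ∀ z ∈ ball c r, ‖f z‖ ≤ M := by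
    have h1 : ∀ᶠ z in 𝓝 c, ‖f z‖ < ‖f c‖ + 1 :=
      (hf.differentiableAt (hU.mem_nhds hc)).continuousAt.norm.eventually_lt_const (by linarith)
    obtain ⟨r, hr, h⟩ := Metric.eventually_nhds_iff_ball.1 (h1.and (hU.mem_nhds hc))
    exact ⟨r, hr, fun z hz => (h z hz).2, _, fun z hz => (h z hz).1.le⟩
  replace hf := hf.mono hrU
  have hM0 : 0 ≤ M := (norm_nonneg _).trans (hM c (mem_ball_self hr))
  set ρ := r / 2 with hρ
  have hρ0 : 0 < ρ := half_pos hr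
  have hsub : ball c ρ ⊆ ball c r := ball_subset_ball (by linarith)
  have hA : ∀ h, ∀ z ∈ ball c r, DifferentiableAt ℂ (fun w => fderiv ℂ f w h) z :=
    fun h z hz => differentiableAt_fderiv_apply hf hM hz h
  have hAon : ∀ h, DifferentiableOn ℂ (fun w => fderiv ℂ f w h) (ball c ρ) :=
    fun h z hz => (hA h z (hsub hz)).differentiableWithinAt
  have hcr := mem_ball_self (x := c) hr
  have hb : ∀ h, ∀ z ∈ ball c ρ, ‖fderiv ℂ f z h‖ ≤ 2 * M / ρ * ‖h‖ := fun h z hz =>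
    (fderiv ℂ f z).le_of_opNorm_le (norm_fderiv_le_of_bounded_ball hρ0 hf hM
      (by convert hz using 2; rw [hρ]; ring)) h
  -- The candidate second derivative; it is bounded because Cauchy's estimate applies twice.
  let L : E →L[ℂ] E →L[ℂ] F := (LinearMap.mk₂ ℂ
    (fun k h => fderiv ℂ (fun w => fderiv ℂ f w h) c k) (by simp) (by simp)
    (fun k h h' => by
      have := fderiv_add (hA h c hcr) (hA h' c hcr)
      simp only [map_add]
      rw [← add_apply, ← this]; rfl)
    (fun a k h => by
      have := fderiv_const_smul (hA h c hcr) a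
      simp only [map_smul]
      rw [← smul_apply, ← this]; rfl)).mkContinuous₂ (2 * (2 * M / ρ) / ρ)
    (fun k h => by
      have := norm_fderiv_le_of_bounded hρ0 (hAon h) (hb h)
      refine ((fderiv ℂ (fun w => fderiv ℂ f w h) c).le_of_opNorm_le this k).trans_eq ?_
      ring)
  have hL : ∀ k h, L k h = fderiv ℂ (fun w => fderiv ℂ f w h) c k := fun k h => rfl
  refine HasFDerivAt.differentiableAt (f' := L) ?_
  rw [hasFDerivAt_iff_isLittleO]
  -- The Taylor bound for each direction `h` is linear in `‖h‖`, so it is a bound in operator norm.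
  have hO : (fun z => fderiv ℂ f z - fderiv ℂ f c - L (z - c)) =O[𝓝 c]
      fun z => ‖z - c‖ ^ 2 := by
    refine Asymptotics.IsBigO.of_bound (4 * (2 * M / ρ) / ρ ^ 2) ?_
    filter_upwards [ball_mem_nhds c hρ0] with z hz
    rw [norm_pow, norm_norm]
    refine ContinuousLinearMap.opNorm_le_bound _ (by positivity) fun h => ?_
    have := norm_sub_sub_fderiv_le (hAon h) (hb h) hz
    simp only [sub_apply, hL]
    refine this.trans_eq ?_
    ring
  refine hO.trans_isLittleO ?_
  have := (Asymptotics.isLittleO_norm_pow_id (E' := E) one_lt_two).comp_tendsto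
    (tendsto_sub_nhds_zero_iff.2 (tendsto_id (x := 𝓝 c)))
  simpa [Function.comp_def] using this

end Banach

end HolomorphicNormalForm

/-! ### Holomorphic inversion near the identity -/

namespace HolomorphicNormalForm

open Metric Filter Topology

section NearIdentity

variable {E : Type*} [NormedAddCommGroup E] [NormedSpace ℂ E] [CompleteSpace E]

/-- A holomorphic map close to the identity on a ball is biholomorphic on a smaller ball, and its
image contains a still smaller one. -/
theorem exists_openPartialHomeomorph_near_id [Nontrivial E] {W : E → E} {ρ σ w : ℝ} (hσ : 0 < σ)
    (hW : DifferentiableOn ℂ W (ball 0 ρ)) (hw : ∀ z ∈ ball 0 ρ, ‖W z‖ ≤ w) (hwσ : 8 * w ≤ σ) :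
    ∃ Ψ : OpenPartialHomeomorph E E, Ψ.source = ball 0 (ρ - σ / 2) ∧ (∀ x, Ψ x = x + W x) ∧
      ball 0 (ρ - σ) ⊆ Ψ.target ∧ DifferentiableOn ℂ Ψ.symm Ψ.target := by
  have hsub : ball (0 : E) (ρ - σ / 2) ⊆ ball 0 ρ := ball_subset_ball (by linarith)
  have hdW : ∀ z ∈ ball (0 : E) (ρ - σ / 2), DifferentiableAt ℂ W z := fun z hz =>
    hW.differentiableAt (isOpen_ball.mem_nhds (hsub hz))
  have hbd : ∀ z ∈ ball (0 : E) (ρ - σ / 2), ‖fderiv ℂ W z‖ ≤ 1 / 2 := fun z hz => by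
    refine (norm_fderiv_le_of_bounded_ball (half_pos hσ) hW hw hz).trans ?_
    rw [div_le_iff₀ (half_pos hσ)]
    linarith
  have happ : ApproximatesLinearOn (fun x => x + W x)
      (ContinuousLinearEquiv.refl ℂ E : E →L[ℂ] E) (ball 0 (ρ - σ / 2)) (1 / 2) := by
    intro x hx y hy
    have := (convex_ball (0 : E) (ρ - σ / 2)).norm_image_sub_le_of_norm_fderiv_le hdW hbd hy hx
    simp only [ContinuousLinearEquiv.coe_refl, ContinuousLinearMap.id_apply]
    convert this using 2
    · abel
    · norm_num
  have hN : ‖((ContinuousLinearEquiv.refl ℂ E).symm : E →L[ℂ] E)‖₊ = 1 := by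
    simp
  have hc : (1 / 2 : NNReal) < ‖((ContinuousLinearEquiv.refl ℂ E).symm : E →L[ℂ] E)‖₊⁻¹ := by
    rw [hN, inv_one, ← NNReal.coe_lt_coe]
    norm_num
  refine ⟨happ.toOpenPartialHomeomorph _ _ (Or.inr hc) isOpen_ball, rfl, fun _ => rfl, ?_, ?_⟩
  · intro y hy
    have hcb : closedBall y (σ / 4) ⊆ ball 0 (ρ - σ / 2) :=
      closedBall_subset_ball' (by rw [mem_ball] at hy; linarith)
    -- Since `W` has Lipschitz constant `1/2`, the image of the closed ball of radius `σ/4` about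
    -- `y` covers the one of radius `σ/8` about `y + W y`; this contains `y` because `8 * w ≤ σ`.
    refine happ.closedBall_subset_target (Or.inr hc) isOpen_ball (by linarith) hcb ?_
    rw [mem_closedBall, dist_comm, dist_eq_norm, hN, add_sub_cancel_left]
    refine (hw y (hsub (hcb (mem_closedBall_self (by linarith))))).trans ?_
    norm_num
    linarith
  · set Ψ := happ.toOpenPartialHomeomorph _ _ (Or.inr hc) isOpen_ball with hΨ
    intro y hy
    refine DifferentiableAt.differentiableWithinAt ?_
    have hx : Ψ.symm y ∈ ball (0 : E) (ρ - σ / 2) := Ψ.map_target hy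
    have hlt : ‖-fderiv ℂ W (Ψ.symm y)‖ < 1 := by
      rw [norm_neg]
      exact (hbd _ hx).trans_lt (by norm_num)
    -- The derivative `1 + DW` is inverted by a Neumann series.
    let e : E ≃L[ℂ] E := ContinuousLinearEquiv.unitsEquiv ℂ E (Units.oneSub _ hlt)
    refine (Ψ.hasFDerivAt_symm (f' := e) hy ?_).differentiableAt
    have h1 : HasFDerivAt (fun x => x + W x)
        (ContinuousLinearMap.id ℂ E + fderiv ℂ W (Ψ.symm y)) (Ψ.symm y) :=
      (hasFDerivAt_id _).add (hdW _ hx).hasFDerivAt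
    have he : (e : E →L[ℂ] E) = ContinuousLinearMap.id ℂ E + fderiv ℂ W (Ψ.symm y) := by
      ext v
      simp [e, Units.oneSub]
    rw [he]
    exact h1

/-- The equation `x + W x = z` with small holomorphic `W` has a holomorphic solution `x = m z`,
unique on a ball. -/
theorem exists_inverse_near_id [Nontrivial E] {W : E → E} {ρ σ w : ℝ} (hσ : 0 < σ)
    (hW : DifferentiableOn ℂ W (ball 0 ρ)) (hw : ∀ z ∈ ball 0 ρ, ‖W z‖ ≤ w) (hwσ : 8 * w ≤ σ) :
    ∃ m : E → E, DifferentiableOn ℂ m (ball 0 (ρ - σ)) ∧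
      (∀ z ∈ ball 0 (ρ - σ), m z ∈ ball 0 (ρ - σ / 2) ∧ m z + W (m z) = z) ∧
      ∀ x ∈ ball 0 (ρ - σ / 2), ∀ z, x + W x = z → m z = x := by
  obtain ⟨Ψ, hsrc, hΨ, htgt, hd⟩ := exists_openPartialHomeomorph_near_id hσ hW hw hwσ
  refine ⟨Ψ.symm, hd.mono htgt, fun z hz => ⟨?_, ?_⟩, fun x hx z hxz => ?_⟩
  · rw [← hsrc]
    exact Ψ.map_target (htgt hz)
  · rw [← hΨ]
    exact Ψ.right_inv (htgt hz)
  · rw [← hxz, ← hΨ]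
    exact Ψ.left_inv (hsrc ▸ hx)

end NearIdentity

end HolomorphicNormalForm

/-! ### Oscillator spaces, Hamiltonians and averages along the periodic flow -/

namespace HolomorphicNormalForm

open Metric Filter Topology ComplexConjugate

/-- A complex Banach space with a symplectic form `ω`, the map `J` sending a differential to its
Hamiltonian vector, a harmonic-oscillator field `A` whose flow is isometric, and a conjugation. -/
structure OscillatorSpace (E : Type*) [NormedAddCommGroup E] [NormedSpace ℂ E] where
  ω : E →L[ℂ] E →L[ℂ] ℂ
  J : (E →L[ℂ] ℂ) →L[ℂ] E
  A : E →L[ℂ] E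
  c : E →L⋆[ℂ] E
  ω_antisymm : ∀ x y, ω x y = -ω y x
  ω_J : ∀ l x, ω (J l) x = l x
  norm_J : ∀ l, ‖J l‖ ≤ ‖l‖
  J_conj : ∀ l l' : E →L[ℂ] ℂ, (∀ x, l' x = conj (l (c x))) → J l' = c (J l)
  ω_c : ∀ x y, ω (c x) (c y) = conj (ω x y)
  A_A : ∀ x, A (A x) = -x
  ω_A : ∀ x y, ω (A x) y = ω (A y) x
  norm_rot : ∀ (t : ℝ) (x : E), ‖(Real.cos t : ℂ) • x + (Real.sin t : ℂ) • A x‖ = ‖x‖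
  c_c : ∀ x, c (c x) = x
  norm_c : ∀ x, ‖c x‖ = ‖x‖
  A_c : ∀ x, A (c x) = c (A x)
  ω_A_self : ∀ x, c x = x → ω (A x) x = ((‖x‖ ^ 2 : ℝ) : ℂ)

variable {E : Type*} [NormedAddCommGroup E] [NormedSpace ℂ E] (S : OscillatorSpace E)

namespace OscillatorSpace

/-- A holomorphic function on the ball of radius `ρ`, with gradient bounded by `M`, and real at
the real points. -/
structure IsHamiltonian (ρ M : ℝ) (f : E → ℂ) : Prop where
  holo : DifferentiableOn ℂ f (ball 0 ρ)
  bound : ∀ z ∈ ball 0 ρ, ‖fderiv ℂ f z‖ ≤ M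
  real : ∀ z ∈ ball 0 ρ, f (S.c z) = conj (f z)

variable {S}

theorem c_mem_ball {ρ : ℝ} {z : E} (hz : z ∈ ball 0 ρ) : S.c z ∈ ball 0 ρ := by
  simpa [S.norm_c] using hz

namespace IsHamiltonian

variable {ρ M : ℝ} {f : E → ℂ}

theorem differentiableAt (hf : S.IsHamiltonian ρ M f) {z : E} (hz : z ∈ ball 0 ρ) :
    DifferentiableAt ℂ f z := hf.holo.differentiableAt (isOpen_ball.mem_nhds hz)

theorem mono (hf : S.IsHamiltonian ρ M f) {ρ' M' : ℝ} (hρ : ρ' ≤ ρ) (hM : M ≤ M') :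
    S.IsHamiltonian ρ' M' f where
  holo := hf.holo.mono (ball_subset_ball hρ)
  bound z hz := (hf.bound z (ball_subset_ball hρ hz)).trans hM
  real z hz := hf.real z (ball_subset_ball hρ hz)

theorem norm_sub_le (hf : S.IsHamiltonian ρ M f) {x y : E} (hx : x ∈ ball 0 ρ)
    (hy : y ∈ ball 0 ρ) : ‖f y - f x‖ ≤ M * ‖y - x‖ :=
  (convex_ball (0 : E) ρ).norm_image_sub_le_of_norm_fderiv_le
    (fun _ hz => hf.differentiableAt hz) hf.bound hx hy

theorem add (hf : S.IsHamiltonian ρ M f) {M' : ℝ} {g : E → ℂ} (hg : S.IsHamiltonian ρ M' g) :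
    S.IsHamiltonian ρ (M + M') (fun z => f z + g z) where
  holo := hf.holo.add hg.holo
  bound z hz := by
    rw [fderiv_fun_add (hf.differentiableAt hz) (hg.differentiableAt hz)]
    exact (norm_add_le _ _).trans (add_le_add (hf.bound z hz) (hg.bound z hz))
  real z hz := by rw [hf.real z hz, hg.real z hz, map_add]

/-- Reality of `f` is differentiated along a complex line; conjugating both the parameter and the
value keeps the derivative complex linear. -/
theorem fderiv_conj (hf : S.IsHamiltonian ρ M f) {z : E} (hz : z ∈ ball 0 ρ) (h : E) :
    fderiv ℂ f (S.c z) h = conj (fderiv ℂ f z (S.c h)) := by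
  have h1 : HasDerivAt (fun t : ℂ => f (S.c z + t • h)) (fderiv ℂ f (S.c z) h) 0 :=
    (hf.differentiableAt (c_mem_ball hz)).hasFDerivAt.hasLineDerivAt h
  have h2 : HasDerivAt (fun t : ℂ => f (z + t • S.c h)) (fderiv ℂ f z (S.c h)) 0 :=
    (hf.differentiableAt hz).hasFDerivAt.hasLineDerivAt (S.c h)
  have h3 := h2.conj_conj
  rw [map_zero] at h3
  refine h1.unique (h3.congr_of_eventuallyEq ?_)
  have h4 : ∀ᶠ t in 𝓝 (0 : ℂ), z + conj t • S.c h ∈ ball (0 : E) ρ := by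
    have hcont : ContinuousAt (fun t : ℂ => z + conj t • S.c h) 0 := by
      refine Continuous.continuousAt ?_
      have := Complex.continuous_conj
      fun_prop
    exact hcont.eventually_mem (by simpa using isOpen_ball.mem_nhds hz)
  filter_upwards [h4] with t ht
  rw [Function.comp_apply, Function.comp_apply, ← hf.real _ ht, map_add, map_smulₛₗ,
    S.c_c, Complex.conj_conj]

/-- The Hamiltonian vector field of a holomorphic function is holomorphic. -/
theorem differentiableOn_field (hf : S.IsHamiltonian ρ M f) :
    DifferentiableOn ℂ (fun z => S.J (fderiv ℂ f z)) (ball 0 ρ) :=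
  S.J.differentiable.comp_differentiableOn (differentiableOn_fderiv isOpen_ball hf.holo)

theorem norm_field_le (hf : S.IsHamiltonian ρ M f) {z : E} (hz : z ∈ ball 0 ρ) :
    ‖S.J (fderiv ℂ f z)‖ ≤ M := (S.norm_J _).trans (hf.bound z hz)

theorem field_conj (hf : S.IsHamiltonian ρ M f) {z : E} (hz : z ∈ ball 0 ρ) :
    S.J (fderiv ℂ f (S.c z)) = S.c (S.J (fderiv ℂ f z)) :=
  S.J_conj _ _ (hf.fderiv_conj hz)

/-- The linearisation of a Hamiltonian vector field is skew for the symplectic form. -/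
theorem ω_fderiv_field (hf : S.IsHamiltonian ρ M f) {z : E} (hz : z ∈ ball 0 ρ) (h k : E) :
    S.ω (fderiv ℂ (fun z => S.J (fderiv ℂ f z)) z h) k
      + S.ω h (fderiv ℂ (fun z => S.J (fderiv ℂ f z)) z k) = 0 := by
  have hd : DifferentiableAt ℂ (fderiv ℂ f) z :=
    (differentiableOn_fderiv isOpen_ball hf.holo).differentiableAt (isOpen_ball.mem_nhds hz)
  have h1 : fderiv ℂ (fun z => S.J (fderiv ℂ f z)) z
      = S.J.comp (fderiv ℂ (fderiv ℂ f) z) :=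
    (S.J.hasFDerivAt.comp z hd.hasFDerivAt).fderiv
  have hsymm := second_derivative_symmetric_of_eventually (𝕜 := ℂ) (f := f) (f' := fderiv ℂ f)
    (x := z) (by
      filter_upwards [isOpen_ball.mem_nhds hz] with y hy
      exact (hf.differentiableAt hy).hasFDerivAt) hd.hasFDerivAt h k
  rw [h1, S.ω_antisymm h, ContinuousLinearMap.comp_apply, ContinuousLinearMap.comp_apply, S.ω_J,
    S.ω_J, hsymm, add_neg_cancel]

end IsHamiltonian

variable (S)

/-- The time `t` flow of the harmonic oscillators. -/
def rot (t : ℝ) : E →L[ℂ] E :=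
  (Real.cos t : ℂ) • ContinuousLinearMap.id ℂ E + (Real.sin t : ℂ) • S.A

theorem rot_apply (t : ℝ) (z : E) :
    S.rot t z = (Real.cos t : ℂ) • z + (Real.sin t : ℂ) • S.A z := rfl

theorem norm_rot_apply (t : ℝ) (z : E) : ‖S.rot t z‖ = ‖z‖ := S.norm_rot t z

theorem norm_rot_le (t : ℝ) : ‖S.rot t‖ ≤ 1 :=
  ContinuousLinearMap.opNorm_le_bound _ zero_le_one fun z => by simp [S.norm_rot_apply]

theorem norm_A (z : E) : ‖S.A z‖ = ‖z‖ := by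
  have := S.norm_rot (Real.pi / 2) z
  simpa only [Real.cos_pi_div_two, Real.sin_pi_div_two, Complex.ofReal_zero, zero_smul, zero_add,
    Complex.ofReal_one, one_smul] using this

theorem rot_mem_ball {ρ : ℝ} {z : E} (hz : z ∈ ball 0 ρ) (t : ℝ) : S.rot t z ∈ ball 0 ρ := by
  simpa [S.norm_rot_apply] using hz

theorem rot_zero (z : E) : S.rot 0 z = z := by simp [rot_apply]

theorem rot_two_pi (z : E) : S.rot (2 * Real.pi) z = z := by
  rw [rot_apply, Real.cos_two_pi, Real.sin_two_pi]
  simp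

theorem rot_conj (t : ℝ) (z : E) : S.rot t (S.c z) = S.c (S.rot t z) := by
  simp only [rot_apply, map_add, map_smulₛₗ, Complex.conj_ofReal, S.A_c]

theorem continuous_rot : Continuous S.rot := by
  have h1 : Continuous fun t : ℝ => (Real.cos t : ℂ) := Complex.continuous_ofReal.comp
    Real.continuous_cos
  have h2 : Continuous fun t : ℝ => (Real.sin t : ℂ) := Complex.continuous_ofReal.comp
    Real.continuous_sin
  exact (h1.smul continuous_const).add (h2.smul continuous_const)

theorem hasDerivAt_rot (t : ℝ) (z : E) :
    HasDerivAt (fun s => S.rot s z) (S.rot t (S.A z)) t := by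
  have h : HasDerivAt (fun s => S.rot s z) _ t :=
    ((Real.hasDerivAt_cos t).ofReal_comp.smul_const z).add
      ((Real.hasDerivAt_sin t).ofReal_comp.smul_const (S.A z))
  refine h.congr_deriv ?_
  rw [rot_apply, S.A_A]
  push_cast
  module

/-- The weighted average of a function along the oscillator flow. -/
def avg (a : ℝ → ℝ) (f : E → ℂ) (z : E) : ℂ :=
  ((2 * Real.pi)⁻¹ : ℝ) * ∫ s in (0 : ℝ)..2 * Real.pi, (a s : ℂ) * f (S.rot s z)

variable {S}

namespace IsHamiltonian

variable {ρ M : ℝ} {f : E → ℂ}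

theorem continuous_comp_rot (hf : S.IsHamiltonian ρ M f) {z : E} (hz : z ∈ ball 0 ρ) :
    Continuous fun s => f (S.rot s z) :=
  hf.holo.continuousOn.comp_continuous (S.continuous_rot.clm_apply continuous_const)
    fun s => S.rot_mem_ball hz s

theorem continuous_fderiv_comp_rot (hf : S.IsHamiltonian ρ M f) {z : E} (hz : z ∈ ball 0 ρ) :
    Continuous fun s => fderiv ℂ f (S.rot s z) :=
  (differentiableOn_fderiv isOpen_ball hf.holo).continuousOn.comp_continuous
    (S.continuous_rot.clm_apply continuous_const) fun s => S.rot_mem_ball hz s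

theorem hasFDerivAt_avg (hf : S.IsHamiltonian ρ M f) {a : ℝ → ℝ} (ha : Continuous a) {C : ℝ}
    (haC : ∀ s ∈ uIoc 0 (2 * Real.pi), |a s| ≤ C) {z : E} (hz : z ∈ ball 0 ρ) :
    HasFDerivAt (S.avg a f) (((2 * Real.pi)⁻¹ : ℂ) • ∫ s in (0 : ℝ)..2 * Real.pi,
      (a s : ℂ) • (fderiv ℂ f (S.rot s z)).comp (S.rot s)) z := by
  have hac : Continuous fun s => (a s : ℂ) := Complex.continuous_ofReal.comp ha
  have hM : 0 ≤ M := (norm_nonneg _).trans (hf.bound z hz)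
  have key := intervalIntegral.hasFDerivAt_integral_of_dominated_of_fderiv_le (𝕜 := ℂ)
    (μ := MeasureTheory.volume) (a := 0) (b := 2 * Real.pi)
    (F := fun z s => (a s : ℂ) * f (S.rot s z))
    (F' := fun z s => (a s : ℂ) • (fderiv ℂ f (S.rot s z)).comp (S.rot s))
    (bound := fun _ => C * M) (x₀ := z) (isOpen_ball.mem_nhds hz) ?_ ?_ ?_ ?_ ?_ ?_
  · have havg : S.avg a f = fun w => ((2 * Real.pi)⁻¹ : ℂ) *
        ∫ s in (0 : ℝ)..2 * Real.pi, (a s : ℂ) * f (S.rot s w) := by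
      ext w
      simp [OscillatorSpace.avg]
    rw [havg]
    exact key.const_mul _
  · filter_upwards [isOpen_ball.mem_nhds hz] with w hw
    exact (hac.mul (hf.continuous_comp_rot hw)).aestronglyMeasurable
  · exact (hac.mul (hf.continuous_comp_rot hz)).intervalIntegrable _ _
  · exact (hac.smul ((hf.continuous_fderiv_comp_rot hz).clm_comp
      S.continuous_rot)).aestronglyMeasurable
  · refine Eventually.of_forall fun s hs w hw => ?_
    rw [norm_smul, Complex.norm_real]
    have h1 : ‖(fderiv ℂ f (S.rot s w)).comp (S.rot s)‖ ≤ M * 1 :=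
      (ContinuousLinearMap.opNorm_comp_le _ _).trans
        (mul_le_mul (hf.bound _ (S.rot_mem_ball hw s)) (S.norm_rot_le s) (norm_nonneg _) hM)
    rw [mul_one] at h1
    exact mul_le_mul (haC s hs) h1 (norm_nonneg _) ((abs_nonneg _).trans (haC s hs))
  · exact intervalIntegrable_const
  · refine Eventually.of_forall fun s _ w hw => ?_
    exact ((hf.differentiableAt (S.rot_mem_ball hw s)).hasFDerivAt.comp w
      (S.rot s).hasFDerivAt).const_mul _

/-- The rotations are isometric and commute with the conjugation, so averaging loses no domain,
keeps reality for real weights, and enlarges the gradient at most by the size of the weight. -/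
theorem avg (hf : S.IsHamiltonian ρ M f) {a : ℝ → ℝ} (ha : Continuous a) {C : ℝ}
    (haC : ∀ s ∈ uIoc 0 (2 * Real.pi), |a s| ≤ C) : S.IsHamiltonian ρ (C * M) (S.avg a f) where
  holo z hz := (hf.hasFDerivAt_avg ha haC hz).differentiableAt.differentiableWithinAt
  bound z hz := by
    have hM : 0 ≤ M := (norm_nonneg _).trans (hf.bound z hz)
    have hpi := Real.pi_pos
    rw [(hf.hasFDerivAt_avg ha haC hz).fderiv, norm_smul]
    have h := intervalIntegral.norm_integral_le_of_norm_le_const (a := 0) (b := 2 * Real.pi)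
      (C := C * M) (f := fun s => (a s : ℂ) • (fderiv ℂ f (S.rot s z)).comp (S.rot s))
      fun s hs => by
        rw [norm_smul, Complex.norm_real]
        have h1 : ‖(fderiv ℂ f (S.rot s z)).comp (S.rot s)‖ ≤ M * 1 :=
          (ContinuousLinearMap.opNorm_comp_le _ _).trans
            (mul_le_mul (hf.bound _ (S.rot_mem_ball hz s)) (S.norm_rot_le s) (norm_nonneg _) hM)
        rw [mul_one] at h1
        exact mul_le_mul (haC s hs) h1 (norm_nonneg _) ((abs_nonneg _).trans (haC s hs))
    rw [sub_zero, abs_of_pos (by positivity)] at h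
    have h2 : ‖((2 * Real.pi)⁻¹ : ℂ)‖ = (2 * Real.pi)⁻¹ := by
      rw [norm_inv, norm_mul, Complex.norm_real, Real.norm_of_nonneg hpi.le]
      simp
    rw [h2, inv_mul_le_iff₀ (by positivity)]
    linarith
  real z hz := by
    simp only [OscillatorSpace.avg]
    rw [map_mul, Complex.conj_ofReal]
    congr 1
    have : conj (∫ s in (0 : ℝ)..2 * Real.pi, (a s : ℂ) * f (S.rot s z))
        = ∫ s in (0 : ℝ)..2 * Real.pi, conj ((a s : ℂ) * f (S.rot s z)) :=
      (Complex.conjCLE.toContinuousLinearMap.intervalIntegral_comp_comm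
        (((Complex.continuous_ofReal.comp ha).mul
          (hf.continuous_comp_rot hz)).intervalIntegrable _ _)).symm
    rw [this]
    refine intervalIntegral.integral_congr fun s _ => ?_
    simp only [map_mul, Complex.conj_ofReal]
    rw [S.rot_conj, hf.real _ (S.rot_mem_ball hz s)]

theorem hasDerivAt_comp_rot (hf : S.IsHamiltonian ρ M f) {z : E} (hz : z ∈ ball 0 ρ) (s : ℝ) :
    HasDerivAt (fun s => f (S.rot s z)) (fderiv ℂ f (S.rot s z) (S.rot s (S.A z))) s := by
  have h := (hf.differentiableAt (S.rot_mem_ball hz s)).hasFDerivAt.restrictScalars ℝ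
  exact h.comp_hasDerivAt s (S.hasDerivAt_rot s z)

/-- Differentiating a weighted average along the flow, after an integration by parts. -/
theorem fderiv_avg_A (hf : S.IsHamiltonian ρ M f) {a a' : ℝ → ℝ} (ha' : Continuous a')
    (haa' : ∀ s, HasDerivAt a (a' s) s) {C : ℝ}
    (haC : ∀ s ∈ uIoc 0 (2 * Real.pi), |a s| ≤ C) {z : E} (hz : z ∈ ball 0 ρ) :
    fderiv ℂ (S.avg a f) z (S.A z)
      = ((2 * Real.pi)⁻¹ : ℝ) * ((a (2 * Real.pi) - a 0 : ℝ) : ℂ) * f z - S.avg a' f z := by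
  have ha : Continuous a := continuous_iff_continuousAt.2 fun s => (haa' s).continuousAt
  have hac : Continuous fun s => (a s : ℂ) := Complex.continuous_ofReal.comp ha
  have hG : Continuous fun s => fderiv ℂ f (S.rot s z) (S.rot s (S.A z)) :=
    (hf.continuous_fderiv_comp_rot hz).clm_apply (S.continuous_rot.clm_apply continuous_const)
  have hint : IntervalIntegrable (fun s => (a s : ℂ) • (fderiv ℂ f (S.rot s z)).comp (S.rot s))
      MeasureTheory.volume 0 (2 * Real.pi) :=
    (hac.smul ((hf.continuous_fderiv_comp_rot hz).clm_comp S.continuous_rot)).intervalIntegrable _ _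
  rw [(hf.hasFDerivAt_avg ha haC hz).fderiv, smul_apply,
    ContinuousLinearMap.intervalIntegral_apply hint]
  -- As `A` commutes with its flow, the integrand is a total derivative in `s` times the weight. By
  -- periodicity the boundary term involves only `f z`.
  have hparts := intervalIntegral.integral_mul_deriv_eq_deriv_mul (a := 0) (b := 2 * Real.pi)
    (u := fun s => (a s : ℂ)) (v := fun s => f (S.rot s z)) (u' := fun s => (a' s : ℂ))
    (v' := fun s => fderiv ℂ f (S.rot s z) (S.rot s (S.A z)))
    (fun s _ => (haa' s).ofReal_comp) (fun s _ => hf.hasDerivAt_comp_rot hz s)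
    ((Complex.continuous_ofReal.comp ha').intervalIntegrable _ _) (hG.intervalIntegrable _ _)
  simp only [smul_apply, ContinuousLinearMap.comp_apply, smul_eq_mul]
  rw [hparts]
  simp only [S.rot_zero, S.rot_two_pi, OscillatorSpace.avg]
  push_cast
  ring

end IsHamiltonian

end OscillatorSpace

end HolomorphicNormalForm

/-! ### The midpoint map and the averaging iteration -/

namespace HolomorphicNormalForm

open Metric Filter Topology ComplexConjugate

namespace OscillatorSpace

variable {E : Type*} [NormedAddCommGroup E] [NormedSpace ℂ E] (S : OscillatorSpace E)

/-- The energy of the harmonic oscillators, half the quadratic form `ω (A z) z`. -/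
def energy (z : E) : ℂ := S.ω (S.A z) z / 2

/-- The increment of a quadratic form over a segment is exactly its differential at the midpoint.
This is why the midpoint map is used as the canonical transformation. -/
theorem energy_midpoint (m x : E) :
    S.energy (m + (1 / 2 : ℂ) • x) = S.energy (m + -(1 / 2 : ℂ) • x) + S.ω (S.A m) x := by
  have := S.ω_A x m
  simp only [energy, map_add, map_smul, add_apply, smul_apply, smul_eq_mul]
  linear_combination (1 / 2 : ℂ) * this

/-- A holomorphic symplectic map on the ball of radius `ρ`, commuting with the conjugation. -/
structure IsSymplecticMap (ρ : ℝ) (T : E → E) : Prop where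
  holo : DifferentiableOn ℂ T (ball 0 ρ)
  sympl : ∀ z ∈ ball 0 ρ, ∀ h k, S.ω (fderiv ℂ T z h) (fderiv ℂ T z k) = S.ω h k
  real : ∀ z ∈ ball 0 ρ, T (S.c z) = S.c (T z)

variable {S}

namespace IsSymplecticMap

variable {ρ : ℝ} {T : E → E}

theorem mono (hT : S.IsSymplecticMap ρ T) {ρ' : ℝ} (hρ : ρ' ≤ ρ) : S.IsSymplecticMap ρ' T where
  holo := hT.holo.mono (ball_subset_ball hρ)
  sympl z hz := hT.sympl z (ball_subset_ball hρ hz)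
  real z hz := hT.real z (ball_subset_ball hρ hz)

theorem comp (hT : S.IsSymplecticMap ρ T) {ρ' : ℝ} {T' : E → E} (hT' : S.IsSymplecticMap ρ' T')
    (hmaps : MapsTo T' (ball 0 ρ') (ball 0 ρ)) : S.IsSymplecticMap ρ' (T ∘ T') where
  holo := hT.holo.comp hT'.holo hmaps
  sympl z hz h k := by
    rw [fderiv_comp z (hT.holo.differentiableAt (isOpen_ball.mem_nhds (hmaps hz)))
      (hT'.holo.differentiableAt (isOpen_ball.mem_nhds hz)), ContinuousLinearMap.comp_apply,
      ContinuousLinearMap.comp_apply, hT.sympl _ (hmaps hz), hT'.sympl z hz]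
  real z hz := by
    rw [Function.comp_apply, Function.comp_apply, hT'.real z hz, hT.real _ (hmaps hz)]

end IsSymplecticMap

variable [CompleteSpace E] [Nontrivial E]

/-- The implicit midpoint map of a small Hamiltonian is symplectic. -/
theorem IsHamiltonian.exists_midpoint_map {χ : E → ℂ} {ρ σ x : ℝ} (hχ : S.IsHamiltonian ρ x χ)
    (hσ : 0 < σ) (hxσ : 4 * x ≤ σ) :
    ∃ m : E → E, (∀ z ∈ ball 0 (ρ - σ), m z ∈ ball 0 (ρ - σ / 2) ∧
        m z + -(1 / 2 : ℂ) • S.J (fderiv ℂ χ (m z)) = z) ∧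
      DifferentiableOn ℂ m (ball 0 (ρ - σ)) ∧ (∀ z ∈ ball 0 (ρ - σ), m (S.c z) = S.c (m z)) ∧
      S.IsSymplecticMap (ρ - σ) fun z => m z + (1 / 2 : ℂ) • S.J (fderiv ℂ χ (m z)) := by
  set X : E → E := fun z => S.J (fderiv ℂ χ z) with hX
  have hXd : DifferentiableOn ℂ X (ball 0 ρ) := hχ.differentiableOn_field
  have hsub : ball (0 : E) (ρ - σ / 2) ⊆ ball 0 ρ := ball_subset_ball (by linarith)
  have hhalf : ‖(-(1 / 2) : ℂ)‖ = 1 / 2 := by norm_num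
  have hconj : conj (1 / 2 : ℂ) = 1 / 2 := by rw [map_div₀, map_one, map_ofNat]
  obtain ⟨m, hmd, hm, hmu⟩ := exists_inverse_near_id (W := fun z => -(1 / 2 : ℂ) • X z)
    (w := x / 2) hσ (hXd.const_smul _) (fun z hz => by
      rw [norm_smul, hhalf]
      linarith [hχ.norm_field_le hz]) (by linarith)
  have hreal : ∀ z ∈ ball 0 (ρ - σ), m (S.c z) = S.c (m z) := fun z hz => by
    obtain ⟨h1, h2⟩ := hm z hz
    -- By uniqueness it suffices that the conjugate of the solution solves the conjugate equation.
    refine hmu _ (c_mem_ball h1) _ ?_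
    simp only [hX] at h2 ⊢
    rw [hχ.field_conj (hsub h1)]
    conv_rhs => rw [← h2]
    rw [map_add, map_smulₛₗ, map_neg, hconj]
  refine ⟨m, hm, hmd, hreal, hmd.add ((hXd.comp hmd fun z hz => hsub (hm z hz).1).const_smul _),
    fun z hz h k => ?_, fun z hz => ?_⟩
  · have hmz := hsub (hm z hz).1
    have hdm := (hmd.differentiableAt (isOpen_ball.mem_nhds hz)).hasFDerivAt
    have hdX := (hXd.differentiableAt (isOpen_ball.mem_nhds hmz)).hasFDerivAt
    have hplus := (hdm.add ((hdX.comp z hdm).const_smul (1 / 2 : ℂ))).fderiv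
    have hminus := hdm.add ((hdX.comp z hdm).const_smul (-(1 / 2) : ℂ))
    -- Differentiating the midpoint equation gives `Dm - DX Dm / 2 = id`, whereas the map has
    -- derivative `Dm + DX Dm / 2`. In the difference of the two pullbacks of `ω` only the cross
    -- terms survive, and they cancel since `DX` is skew.
    have hid : HasFDerivAt (m + (-(1 / 2) : ℂ) • X ∘ m) (ContinuousLinearMap.id ℂ E) z := by
      refine (hasFDerivAt_id z).congr_of_eventuallyEq ?_
      filter_upwards [isOpen_ball.mem_nhds hz] with y hy
      exact (hm y hy).2
    have heq := fun v => congrArg (fun l : E →L[ℂ] E => l v) (hminus.unique hid)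
    have hsk := hχ.ω_fderiv_field hmz (fderiv ℂ m z h) (fderiv ℂ m z k)
    rw [← hX] at hsk
    have hpl : fderiv ℂ (fun z => m z + (1 / 2 : ℂ) • X (m z)) z = _ := hplus
    rw [hpl]
    conv_rhs => rw [← ContinuousLinearMap.id_apply (R₁ := ℂ) h, ← ContinuousLinearMap.id_apply
      (R₁ := ℂ) k, ← heq h, ← heq k]
    simp only [add_apply, smul_apply, ContinuousLinearMap.comp_apply, map_add, map_smul,
      smul_eq_mul]
    linear_combination hsk
  · have h1 : X (m (S.c z)) = S.c (X (m z)) := by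
      rw [hreal z hz]
      exact hχ.field_conj (hsub (hm z hz).1)
    change m (S.c z) + (1 / 2 : ℂ) • X (m (S.c z)) = S.c (m z + (1 / 2 : ℂ) • X (m z))
    rw [h1, hreal z hz, map_add, map_smulₛₗ, hconj]

/-- One step of the averaging procedure. -/
theorem exists_averaging_step {P Z : E → ℂ} {ρ s a b : ℝ} (hP : S.IsHamiltonian ρ a P)
    (hZ : S.IsHamiltonian ρ b Z) (hZA : ∀ z ∈ ball 0 ρ, fderiv ℂ Z z (S.A z) = 0) (ha : 0 ≤ a)
    (hb : 0 ≤ b) (hs : 0 < s) (hab : 64 * (a + b) ≤ s) :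
    ∃ (T : E → E) (Z' P' : E → ℂ), S.IsSymplecticMap (ρ - s) T ∧
      MapsTo T (ball 0 (ρ - s)) (ball 0 ρ) ∧ (∀ z ∈ ball 0 (ρ - s), ‖T z - z‖ ≤ 4 * a) ∧
      S.IsHamiltonian (ρ - s) (b + a) Z' ∧
      (∀ z ∈ ball 0 (ρ - s), fderiv ℂ Z' z (S.A z) = 0) ∧
      S.IsHamiltonian (ρ - s) (a / 4) P' ∧
      ∀ z ∈ ball 0 (ρ - s), S.energy (T z) + Z (T z) + P (T z) = S.energy z + Z' z + P' z := by
  have hpi := Real.pi_pos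
  have hone : ∀ t ∈ uIoc 0 (2 * Real.pi), |(fun _ => 1 : ℝ → ℝ) t| ≤ 1 := fun t _ => by simp
  have hlin : ∀ t ∈ uIoc 0 (2 * Real.pi), |(fun t => t - Real.pi) t| ≤ 4 := fun t ht => by
    rw [uIoc_of_le (by positivity)] at ht
    rw [abs_le]
    constructor <;> linarith [ht.1, ht.2, Real.pi_le_four]
  set Q : E → ℂ := S.avg (fun _ => 1) P with hQdef
  -- The weight has slope 1 and jumps by `2π` over a period: the boundary term of the integration by
  -- parts produces `P`, the remaining integral `Q`. Its size is bounded by `π ≤ 4`.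
  set χ : E → ℂ := S.avg (fun t => t - Real.pi) P with hχdef
  have hQ : S.IsHamiltonian ρ a Q := by
    simpa using hP.avg (a := fun _ => 1) continuous_const hone
  have hχ : S.IsHamiltonian ρ (4 * a) χ := hP.avg (by fun_prop) hlin
  have hχA : ∀ z ∈ ball 0 ρ, fderiv ℂ χ z (S.A z) = P z - Q z := fun z hz => by
    rw [hP.fderiv_avg_A (a := fun t => t - Real.pi) (a' := fun _ => 1) continuous_const
      (fun t => (hasDerivAt_id t).sub_const _) hlin hz]
    congr 1
    have : ((2 * Real.pi)⁻¹ : ℝ) * ((2 * Real.pi - Real.pi - (0 - Real.pi) : ℝ) : ℂ) = 1 := by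
      rw [← Complex.ofReal_mul]
      norm_cast
      field_simp
      ring
    rw [this, one_mul]
  have hQA : ∀ z ∈ ball 0 ρ, fderiv ℂ Q z (S.A z) = 0 := fun z hz => by
    rw [hP.fderiv_avg_A (a := fun _ => 1) (a' := fun _ => 0) continuous_const
      (fun t => hasDerivAt_const t 1) hone hz]
    simp [avg]
  -- Half of the loss `s` pays for the midpoint map, the other half for Cauchy's estimate on the new
  -- remainder.
  obtain ⟨m, hm, hmd, hmc, hT⟩ := hχ.exists_midpoint_map (σ := s / 2) (by linarith) (by linarith)
  set X : E → E := fun z => S.J (fderiv ℂ χ z) with hX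
  set T : E → E := fun z => m z + (1 / 2 : ℂ) • X (m z) with hTdef
  have hsub1 : ball (0 : E) (ρ - s / 2 / 2) ⊆ ball 0 ρ := ball_subset_ball (by linarith)
  have hsub2 : ball (0 : E) (ρ - s / 2) ⊆ ball 0 ρ := ball_subset_ball (by linarith)
  have hsub3 : ball (0 : E) (ρ - s) ⊆ ball 0 (ρ - s / 2) := ball_subset_ball (by linarith)
  have hmρ : ∀ z ∈ ball (0 : E) (ρ - s / 2), m z ∈ ball 0 ρ := fun z hz => hsub1 (hm z hz).1
  have hXm : ∀ z ∈ ball (0 : E) (ρ - s / 2), ‖X (m z)‖ ≤ 4 * a := fun z hz =>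
    hχ.norm_field_le (hmρ z hz)
  have hhalfX : ∀ z ∈ ball (0 : E) (ρ - s / 2), ‖(1 / 2 : ℂ) • X (m z)‖ ≤ 2 * a := fun z hz => by
    rw [norm_smul]
    norm_num
    linarith [hXm z hz]
  have hmz : ∀ z ∈ ball (0 : E) (ρ - s / 2), m z - z = (1 / 2 : ℂ) • X (m z) := fun z hz => by
    have := (hm z hz).2
    rwa [neg_smul, ← sub_eq_add_neg, sub_eq_iff_eq_add, ← sub_eq_iff_eq_add'] at this
  have hTm : ∀ z, T z - m z = (1 / 2 : ℂ) • X (m z) := fun z => by simp [hTdef]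
  have hTz : ∀ z ∈ ball (0 : E) (ρ - s / 2), ‖T z - z‖ ≤ 4 * a := fun z hz => by
    rw [← sub_add_sub_cancel (T z) (m z) z, hmz z hz, hTm]
    exact (norm_add_le _ _).trans (by linarith [hhalfX z hz])
  have hTρ : ∀ z ∈ ball (0 : E) (ρ - s / 2), T z ∈ ball 0 ρ := fun z hz => by
    have h1 := mem_ball_zero_iff.1 (hm z hz).1
    rw [mem_ball_zero_iff]
    refine (norm_add_le _ _).trans_lt ?_
    linarith [hhalfX z hz]
  have hd : ∀ {f : E → ℂ} {A : E → E}, DifferentiableOn ℂ f (ball 0 ρ) →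
      DifferentiableOn ℂ A (ball 0 (ρ - s / 2)) → (∀ z ∈ ball (0 : E) (ρ - s / 2), A z ∈ ball 0 ρ) →
      DifferentiableOn ℂ (fun z => f (A z)) (ball 0 (ρ - s / 2)) := fun hf hA hmaps =>
    hf.comp hA hmaps
  -- The energy contributes `Q (m z) - P (m z)`, which explains the evaluations at the midpoint. The
  -- three increments are at most `2a²`, `2a²` and `4ab`.
  let P' : E → ℂ := fun z => (Q (m z) - Q z) + (P (T z) - P (m z)) + (Z (T z) - Z z)
  have hP'd : DifferentiableOn ℂ P' (ball 0 (ρ - s / 2)) :=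
    (((hd hQ.holo hmd hmρ).sub (hQ.holo.mono hsub2)).add
      ((hd hP.holo hT.holo hTρ).sub (hd hP.holo hmd hmρ))).add
      ((hd hZ.holo hT.holo hTρ).sub (hZ.holo.mono hsub2))
  have hP'b : ∀ z ∈ ball 0 (ρ - s / 2), ‖P' z‖ ≤ 4 * a * (a + b) := fun z hz => by
    have h1 := hQ.norm_sub_le (hsub2 hz) (hmρ z hz)
    have h2 := hP.norm_sub_le (hmρ z hz) (hTρ z hz)
    have h3 := hZ.norm_sub_le (hsub2 hz) (hTρ z hz)
    rw [hmz z hz] at h1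
    rw [hTm] at h2
    have h4 := mul_le_mul_of_nonneg_left (hhalfX z hz) ha
    have h5 := mul_le_mul_of_nonneg_left (hTz z hz) hb
    refine (norm_add₃_le).trans ?_
    linarith
  refine ⟨T, fun z => Z z + Q z, P', hT.mono (by linarith), fun z hz => hTρ z (hsub3 hz),
    fun z hz => hTz z (hsub3 hz), (hZ.add hQ).mono (by linarith) le_rfl, fun z hz => ?_,
    ⟨hP'd.mono hsub3, fun z hz => ?_, fun z hz => ?_⟩, fun z hz => ?_⟩
  · have hz' := hsub2 (hsub3 hz)
    rw [fderiv_fun_add (hZ.differentiableAt hz') (hQ.differentiableAt hz'), add_apply, hZA z hz',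
      hQA z hz', add_zero]
  · have hz' : z ∈ ball 0 (ρ - s / 2 - s / 2) := by convert hz using 2; ring
    refine (norm_fderiv_le_of_bounded_ball (half_pos hs) hP'd hP'b hz').trans ?_
    rw [div_le_iff₀ (half_pos hs)]
    nlinarith
  · have hz' := hsub3 hz
    simp only [P', map_add, map_sub]
    rw [hT.real z hz', hmc z hz', hQ.real _ (hmρ z hz'), hQ.real _ (hsub2 hz'),
      hP.real _ (hTρ z hz'), hP.real _ (hmρ z hz'), hZ.real _ (hTρ z hz'), hZ.real _ (hsub2 hz')]
  · have hz' := hsub3 hz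
    have h1 := S.energy_midpoint (m z) (X (m z))
    rw [(hm z hz').2, S.ω_antisymm, S.ω_J, hχA _ (hmρ z hz')] at h1
    change S.energy (T z) = _ at h1
    rw [h1]
    simp only [P']
    ring

/-- The averaging procedure iterated `k` times. -/
theorem exists_normal_form {F : E → ℂ} {ρ s a : ℝ} (hF : S.IsHamiltonian ρ a F) (ha : 0 ≤ a)
    (hs : 0 < s) (has : 128 * a ≤ s) (k : ℕ) :
    ∃ (T : E → E) (Z P : E → ℂ), S.IsSymplecticMap (ρ - k * s) T ∧
      MapsTo T (ball 0 (ρ - k * s)) (ball 0 ρ) ∧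
      (∀ z ∈ ball 0 (ρ - k * s), ‖T z - z‖ ≤ 8 * a * (1 - 4⁻¹ ^ k)) ∧
      S.IsHamiltonian (ρ - k * s) (2 * a * (1 - 4⁻¹ ^ k)) Z ∧
      (∀ z ∈ ball 0 (ρ - k * s), fderiv ℂ Z z (S.A z) = 0) ∧
      S.IsHamiltonian (ρ - k * s) (a * 4⁻¹ ^ k) P ∧
      ∀ z ∈ ball 0 (ρ - k * s), S.energy (T z) + F (T z) = S.energy z + Z z + P z := by
  induction k with
  | zero =>
    refine ⟨id, fun _ => 0, F, ⟨differentiableOn_id, fun z _ h k => by simp, fun z _ => rfl⟩,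
      fun z hz => by simpa using hz, fun z _ => by simp,
      ⟨differentiableOn_const _, fun z _ => by simp, fun z _ => by simp⟩, fun z _ => by simp,
      by simpa using hF, fun z _ => by simp⟩
  | succ k ih =>
    obtain ⟨T, Z, P, hT, hTm, hTd, hZ, hZA, hP, heq⟩ := ih
    have hq0 : (0 : ℝ) ≤ 4⁻¹ ^ k := by positivity
    have hq1 : (4⁻¹ : ℝ) ^ k ≤ 1 := pow_le_one₀ (by norm_num) (by norm_num)
    have haq : 0 ≤ a * 4⁻¹ ^ k := by positivity
    have haq1 : 0 ≤ a * (1 - 4⁻¹ ^ k) := mul_nonneg ha (by linarith)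
    -- The gradients of `Z` and `P` add up to at most `2a` at every stage, so `128 * a ≤ s` meets
    -- the requirement of each step with the same `s`.
    obtain ⟨T', Z', P', hT', hTm', hTd', hZ', hZA', hP', heq'⟩ := exists_averaging_step hP hZ hZA haq
      (by linarith) hs (by nlinarith)
    have hρ : ρ - (k + 1 : ℕ) * s = ρ - k * s - s := by push_cast; ring
    rw [hρ]
    refine ⟨T ∘ T', Z', P', hT.comp hT' hTm', hTm.comp hTm', fun z hz => ?_,
      hZ'.mono le_rfl (by rw [pow_succ]; linarith), hZA', hP'.mono le_rfl (le_of_eq ?_),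
      fun z hz => ?_⟩
    · rw [Function.comp_apply, ← sub_add_sub_cancel _ (T' z) z]
      refine (norm_add_le _ _).trans ((add_le_add (hTd _ (hTm' hz)) (hTd' z hz)).trans ?_)
      rw [pow_succ]
      linarith
    · rw [pow_succ]
      ring
    · rw [← heq' z hz, ← heq _ (hTm' hz)]
      rfl

end OscillatorSpace

end HolomorphicNormalForm

/-! ### Drift along orbits in normal form coordinates -/

namespace HolomorphicNormalForm

open Metric Filter Topology ComplexConjugate

/-- Continuous induction: an estimate that improves itself holds on the whole interval. -/
theorem forall_le_of_bootstrap {f : ℝ → ℝ} {t r₁ r₂ : ℝ} (hf : ContinuousOn f (Icc 0 t))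
    (h0 : f 0 ≤ r₂) (hr : r₂ < r₁)
    (h : ∀ s ∈ Icc 0 t, (∀ u ∈ Icc 0 s, f u ≤ r₁) → f s ≤ r₂) : ∀ s ∈ Icc 0 t, f s ≤ r₂ := by
  have hlt : ∀ s ∈ Icc 0 t, f s < r₁ := by
    by_contra! hcon
    obtain ⟨s₀, hs₀, hs₀'⟩ := hcon
    have hcl : IsClosed (Icc 0 t ∩ f ⁻¹' Ici r₁) :=
      hf.preimage_isClosed_of_isClosed isClosed_Icc isClosed_Ici
    have hcomp : IsCompact (Icc 0 t ∩ f ⁻¹' Ici r₁) :=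
      isCompact_Icc.of_isClosed_subset hcl inter_subset_left
    -- At the first time with `f ≥ r₁` the intermediate value theorem forces equality, so the weak
    -- bound holds up to that time and the strong one contradicts it.
    obtain ⟨s, ⟨hst, hfs⟩, hmin⟩ := hcomp.exists_isLeast ⟨s₀, hs₀, hs₀'⟩
    have hfs' : r₁ ≤ f s := hfs
    have hle : ∀ u ∈ Icc 0 s, f u ≤ r₁ := by
      intro u hu
      rcases hu.2.lt_or_eq with hlt | rfl
      · by_contra! hcon
        exact absurd (hmin ⟨⟨hu.1, hu.2.trans hst.2⟩, hcon.le⟩) (not_le.2 hlt)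
      · obtain ⟨v, hv, hfv⟩ := intermediate_value_Icc hst.1
          (hf.mono (Icc_subset_Icc_right hst.2)) ⟨h0.trans hr.le, hfs'⟩
        have : u ≤ v := hmin ⟨⟨hv.1, hv.2.trans hst.2⟩, hfv.ge⟩
        rw [le_antisymm this hv.2, hfv]
    linarith [h s hst hle]
  exact fun s hs => h s hs fun u hu => (hlt u ⟨hu.1, hu.2.trans hs.2⟩).le

namespace OscillatorSpace

variable {E : Type*} [NormedAddCommGroup E] [NormedSpace ℂ E] {S : OscillatorSpace E}

theorem hasFDerivAt_energy (z : E) : HasFDerivAt S.energy (S.ω (S.A z)) z := by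
  have h := ((S.ω.comp S.A).hasFDerivAt (x := z)).clm_apply (hasFDerivAt_id z)
  have h2 := h.mul_const (2⁻¹ : ℂ)
  have h3 : HasFDerivAt S.energy _ z := h2
  refine h3.congr_fderiv ?_
  ext k
  have := S.ω_A z k
  simp only [add_apply, smul_apply, ContinuousLinearMap.comp_apply, id_eq,
    ContinuousLinearMap.flip_apply, smul_eq_mul, ContinuousLinearMap.id_apply]
  linear_combination -(1 / 2 : ℂ) * this

theorem ω_self (x : E) : S.ω x x = 0 := by
  have := S.ω_antisymm x x
  linear_combination (1 / 2 : ℂ) * this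

theorem energy_of_real {z : E} (hz : S.c z = z) : S.energy z = ((‖z‖ ^ 2 / 2 : ℝ) : ℂ) := by
  rw [energy, S.ω_A_self z hz]
  push_cast
  ring

/-- A Hamiltonian `H` brought to the normal form `energy + Z + P` by the symplectic map `T` on the
ball of radius `ρ`, with an inverse `m` of `T` on the ball of radius `ρm`. -/
structure NormalForm (S : OscillatorSpace E) (H Z P : E → ℂ) (T m : E → E) (ρ ρm e b p : ℝ) :
    Prop where
  sympl : S.IsSymplecticMap ρ T
  near : ∀ z ∈ ball 0 ρ, ‖T z - z‖ ≤ e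
  hZ : S.IsHamiltonian ρ b Z
  hZA : ∀ z ∈ ball 0 ρ, fderiv ℂ Z z (S.A z) = 0
  hP : S.IsHamiltonian ρ p P
  eq : ∀ z ∈ ball 0 ρ, H (T z) = S.energy z + Z z + P z
  holo_m : DifferentiableOn ℂ m (ball 0 ρm)
  maps : MapsTo m (ball 0 ρm) (ball 0 ρ)
  inv : ∀ z ∈ ball 0 ρm, T (m z) = z
  real_m : ∀ z ∈ ball 0 ρm, m (S.c z) = S.c (m z)

namespace NormalForm

variable {H Z P : E → ℂ} {T m : E → E} {ρ ρm e b p : ℝ}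

/-- The Hamiltonian vector field of `H` seen in the normal form coordinates. -/
theorem ω_pullback_field (N : S.NormalForm H Z P T m ρ ρm e b p)
    (hH : ∀ z, DifferentiableAt ℂ H z) {z : E} (hz : z ∈ ball 0 ρm) (k : E) :
    S.ω (fderiv ℂ m z (S.J (fderiv ℂ H z))) k
      = S.ω (S.A (m z)) k + fderiv ℂ Z (m z) k + fderiv ℂ P (m z) k := by
  have hw := N.maps hz
  have hT := N.sympl.holo.differentiableAt (isOpen_ball.mem_nhds hw)
  have hm := N.holo_m.differentiableAt (isOpen_ball.mem_nhds hz)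
  have h1 : (fderiv ℂ T (m z)).comp (fderiv ℂ m z) = ContinuousLinearMap.id ℂ E := by
    refine (hT.hasFDerivAt.comp z hm.hasFDerivAt).unique
      ((hasFDerivAt_id z).congr_of_eventuallyEq ?_)
    filter_upwards [isOpen_ball.mem_nhds hz] with y hy using N.inv y hy
  -- The differential of `H ∘ T` at `m z` is computed by the chain rule and from the normal form;
  -- symplecticity of `DT` then identifies the transported field.
  have h2 : HasFDerivAt (fun w => H (T w)) ((fderiv ℂ H z).comp (fderiv ℂ T (m z))) (m z) := by
    have := (hH (T (m z))).hasFDerivAt.comp (m z) hT.hasFDerivAt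
    rwa [N.inv z hz] at this
  have h3 : HasFDerivAt (fun w => H (T w))
      (S.ω (S.A (m z)) + fderiv ℂ Z (m z) + fderiv ℂ P (m z)) (m z) := by
    refine HasFDerivAt.congr_of_eventuallyEq (((hasFDerivAt_energy (m z)).add
      (N.hZ.differentiableAt hw).hasFDerivAt).add (N.hP.differentiableAt hw).hasFDerivAt) ?_
    filter_upwards [isOpen_ball.mem_nhds hw] with y hy using N.eq y hy
  have h4 := congrArg (fun l : E →L[ℂ] ℂ => l k) (h2.unique h3)
  have h5 := congrArg (fun l : E →L[ℂ] E => l (S.J (fderiv ℂ H z))) h1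
  simp only [ContinuousLinearMap.comp_apply, add_apply, ContinuousLinearMap.id_apply] at h4 h5
  rw [← N.sympl.sympl _ hw, h5, S.ω_J, h4]

/-- The energy commutes with itself and with `Z`, so only the bracket with `P` is left. -/
theorem fderiv_energy_pullback_field (N : S.NormalForm H Z P T m ρ ρm e b p)
    (hH : ∀ z, DifferentiableAt ℂ H z) {z : E} (hz : z ∈ ball 0 ρm) :
    S.ω (S.A (m z)) (fderiv ℂ m z (S.J (fderiv ℂ H z)))
      = -fderiv ℂ P (m z) (S.A (m z)) := by
  rw [S.ω_antisymm, N.ω_pullback_field hH hz, ω_self, N.hZA _ (N.maps hz), zero_add, zero_add]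

/-- Here both `ω(X_Z, X_Z)` and the bracket of `Z` with the energy vanish, and again only `P`
remains. -/
theorem fderiv_Z_pullback_field (N : S.NormalForm H Z P T m ρ ρm e b p)
    (hH : ∀ z, DifferentiableAt ℂ H z) {z : E} (hz : z ∈ ball 0 ρm) :
    fderiv ℂ Z (m z) (fderiv ℂ m z (S.J (fderiv ℂ H z)))
      = -fderiv ℂ P (m z) (S.J (fderiv ℂ Z (m z))) := by
  rw [← S.ω_J (fderiv ℂ Z (m z)), S.ω_antisymm, N.ω_pullback_field hH hz,
    S.ω_antisymm (S.A (m z)), S.ω_J, N.hZA _ (N.maps hz),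
    ← S.ω_J (fderiv ℂ Z (m z)) (S.J (fderiv ℂ Z (m z))), ω_self]
  simp

section Real

variable [NormedSpace ℝ E] [IsScalarTower ℝ ℂ E]

/-- The factor `κ` in front of the field covers both directions of time. -/
theorem norm_sub_le_of_hasDerivWithinAt {f : E → ℂ} {f' : E → E →L[ℂ] ℂ}
    (N : S.NormalForm H Z P T m ρ ρm e b p)
    (hf : ∀ z ∈ ball 0 ρ, HasFDerivAt f (f' z) z) {B : ℝ}
    (hB : ∀ z ∈ ball 0 ρm, ‖f' (m z) (fderiv ℂ m z (S.J (fderiv ℂ H z)))‖ ≤ B)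
    {y : ℝ → E} {t κ : ℝ} (ht : 0 ≤ t) (hκ : |κ| ≤ 1) (hyρ : ∀ s ∈ Icc 0 t, y s ∈ ball 0 ρm)
    (hy : ∀ s ∈ Icc 0 t, HasDerivWithinAt y (κ • S.J (fderiv ℂ H (y s))) (Icc 0 t) s) :
    ‖f (m (y t)) - f (m (y 0))‖ ≤ B * t := by
  have hd : ∀ s ∈ Icc 0 t, HasDerivWithinAt (fun s => f (m (y s)))
      (f' (m (y s)) (fderiv ℂ m (y s) (κ • S.J (fderiv ℂ H (y s))))) (Icc 0 t) s := fun s hs => by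
    have hm := N.holo_m.differentiableAt (isOpen_ball.mem_nhds (hyρ s hs))
    have hfm := ((hf _ (N.maps (hyρ s hs))).comp (y s) hm.hasFDerivAt).restrictScalars ℝ
    exact hfm.comp_hasDerivWithinAt s (hy s hs)
  have hb : ∀ s ∈ Icc 0 t,
      ‖f' (m (y s)) (fderiv ℂ m (y s) (κ • S.J (fderiv ℂ H (y s))))‖ ≤ B := fun s hs => by
    have hκc : κ • S.J (fderiv ℂ H (y s)) = (κ : ℂ) • S.J (fderiv ℂ H (y s)) :=
      (algebraMap_smul ℂ κ _).symm
    rw [hκc, map_smul, map_smul, norm_smul, Complex.norm_real, Real.norm_eq_abs]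
    calc _ ≤ 1 * ‖f' (m (y s)) (fderiv ℂ m (y s) (S.J (fderiv ℂ H (y s))))‖ := by gcongr
      _ ≤ B := by rw [one_mul]; exact hB _ (hyρ s hs)
  have := (convex_Icc 0 t).norm_image_sub_le_of_norm_hasDerivWithin_le hd hb
    (left_mem_Icc.2 ht) (right_mem_Icc.2 ht)
  rwa [sub_zero, Real.norm_of_nonneg ht] at this

theorem norm_energy_sub_le (N : S.NormalForm H Z P T m ρ ρm e b p)
    (hH : ∀ z, DifferentiableAt ℂ H z) {y : ℝ → E} {t κ : ℝ} (ht : 0 ≤ t) (hκ : |κ| ≤ 1)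
    (hyρ : ∀ s ∈ Icc 0 t, y s ∈ ball 0 ρm)
    (hy : ∀ s ∈ Icc 0 t, HasDerivWithinAt y (κ • S.J (fderiv ℂ H (y s))) (Icc 0 t) s) :
    ‖S.energy (m (y t)) - S.energy (m (y 0))‖ ≤ p * ρ * t := by
  refine N.norm_sub_le_of_hasDerivWithinAt (fun z _ => hasFDerivAt_energy z) (fun z hz => ?_)
    ht hκ hyρ hy
  rw [N.fderiv_energy_pullback_field hH hz, norm_neg]
  have hw := N.maps hz
  refine ((fderiv ℂ P (m z)).le_of_opNorm_le (N.hP.bound _ hw) _).trans ?_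
  rw [S.norm_A]
  exact mul_le_mul_of_nonneg_left (mem_ball_zero_iff.1 hw).le
    ((norm_nonneg _).trans (N.hP.bound _ hw))

theorem norm_Z_sub_le (N : S.NormalForm H Z P T m ρ ρm e b p)
    (hH : ∀ z, DifferentiableAt ℂ H z) {y : ℝ → E} {t κ : ℝ} (ht : 0 ≤ t) (hκ : |κ| ≤ 1)
    (hyρ : ∀ s ∈ Icc 0 t, y s ∈ ball 0 ρm)
    (hy : ∀ s ∈ Icc 0 t, HasDerivWithinAt y (κ • S.J (fderiv ℂ H (y s))) (Icc 0 t) s) :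
    ‖Z (m (y t)) - Z (m (y 0))‖ ≤ p * b * t := by
  refine N.norm_sub_le_of_hasDerivWithinAt
    (fun z hz => (N.hZ.differentiableAt hz).hasFDerivAt) (fun z hz => ?_) ht hκ hyρ hy
  rw [N.fderiv_Z_pullback_field hH hz, norm_neg]
  have hw := N.maps hz
  refine ((fderiv ℂ P (m z)).le_of_opNorm_le (N.hP.bound _ hw) _).trans ?_
  exact mul_le_mul_of_nonneg_left (N.hZ.norm_field_le hw)
    ((norm_nonneg _).trans (N.hP.bound _ hw))

end Real

end NormalForm

theorem IsHamiltonian.lipschitzOnWith_field {H : E → ℂ} {r M : ℝ}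
    (hH : S.IsHamiltonian (r + 1) M H) :
    LipschitzOnWith (2 * M).toNNReal (fun z => S.J (fderiv ℂ H z)) (ball 0 r) := by
  have hr1 : r + 1 - 1 = r := by ring
  refine LipschitzOnWith.of_dist_le_mul fun x hx y hy => ?_
  rw [dist_eq_norm, dist_eq_norm]
  have hsub : ball (0 : E) r ⊆ ball 0 (r + 1) := ball_subset_ball (by linarith)
  have hM : 0 ≤ M := (norm_nonneg _).trans (hH.bound x (hsub hx))
  rw [Real.coe_toNNReal _ (by positivity)]
  refine (convex_ball (0 : E) r).norm_image_sub_le_of_norm_fderiv_le (𝕜 := ℂ) (fun z hz =>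
    hH.differentiableOn_field.differentiableAt (isOpen_ball.mem_nhds (hsub hz)))
    (fun z hz => ?_) hy hx
  have := norm_fderiv_le_of_bounded_ball one_pos hH.differentiableOn_field
    (fun z hz => hH.norm_field_le hz) (z := z) (by rwa [hr1])
  simpa using this

section Flow

variable [NormedSpace ℝ E] [IsScalarTower ℝ ℂ E]

/-- Solutions starting at real points stay real. -/
theorem conj_eq_of_hasDerivWithinAt {Y : E → E} (hYc : ∀ z, Y (S.c z) = S.c (Y z))
    (hYL : ∀ r, ∃ K, LipschitzOnWith K Y (ball 0 r)) {y : ℝ → E} {t : ℝ}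
    (hy : ∀ s ∈ Icc 0 t, HasDerivWithinAt y (Y (y s)) (Icc 0 t) s) (h0 : S.c (y 0) = y 0) :
    ∀ s ∈ Icc 0 t, S.c (y s) = y s := by
  have hyc : ContinuousOn y (Icc 0 t) := fun s hs => (hy s hs).continuousWithinAt
  obtain ⟨r, hr⟩ := (isCompact_Icc.image_of_continuousOn hyc).isBounded.subset_ball 0
  obtain ⟨K, hK⟩ := hYL r
  have hmem : ∀ s ∈ Icc 0 t, y s ∈ ball 0 r := fun s hs => hr (mem_image_of_mem y hs)
  let cR : E →L[ℝ] E :=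
    { toFun := S.c
      map_add' := map_add S.c
      map_smul' := fun a x => by
        rw [← algebraMap_smul ℂ a x, map_smulₛₗ, RingHom.id_apply, Complex.coe_algebraMap,
          Complex.conj_ofReal, ← Complex.coe_algebraMap, algebraMap_smul]
      cont := S.c.continuous }
  have hcy : ∀ s ∈ Icc 0 t, HasDerivWithinAt (fun s => S.c (y s)) (Y (S.c (y s))) (Icc 0 t) s :=
    fun s hs => by
      rw [hYc]
      exact cR.hasFDerivAt.comp_hasDerivWithinAt s (hy s hs)
  have hIci : ∀ s ∈ Ico 0 t, Icc 0 t ∈ 𝓝[≥] s := fun s hs =>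
    mem_nhdsWithin.2 ⟨Iio t, isOpen_Iio, hs.2, fun u hu => ⟨hs.1.trans hu.2, hu.1.le⟩⟩
  -- The conjugate orbit solves the same equation with the same initial point; a compact piece of
  -- orbit lies in a ball where the field is Lipschitz.
  have key := ODE_solution_unique_of_mem_Icc_right (v := fun _ => Y) (s := fun _ => ball 0 r)
    (f := fun s => S.c (y s)) (g := y) (a := 0) (b := t) (K := K) (fun _ _ => hK)
    (S.c.continuous.comp_continuousOn hyc)
    (fun s hs => (hcy s (Ico_subset_Icc_self hs)).mono_of_mem_nhdsWithin (hIci s hs))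
    (fun s hs => c_mem_ball (hmem s (Ico_subset_Icc_self hs))) hyc
    (fun s hs => (hy s (Ico_subset_Icc_self hs)).mono_of_mem_nhdsWithin (hIci s hs))
    (fun s hs => hmem s (Ico_subset_Icc_self hs)) h0
  exact key

end Flow

end OscillatorSpace

end HolomorphicNormalForm

/-! ### Stability of real orbits -/

namespace HolomorphicNormalForm

open Metric Filter Topology ComplexConjugate

namespace OscillatorSpace

variable {E : Type*} [NormedAddCommGroup E] [NormedSpace ℂ E] {S : OscillatorSpace E}

namespace NormalForm

variable {H Z P : E → ℂ} {T m : E → E} {ρ ρm e b p : ℝ}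

theorem norm_m_sub_le (N : S.NormalForm H Z P T m ρ ρm e b p) {z : E} (hz : z ∈ ball 0 ρm) :
    ‖m z - z‖ ≤ e := by
  have := N.near _ (N.maps hz)
  rwa [N.inv z hz, norm_sub_rev] at this

theorem m_of_real (N : S.NormalForm H Z P T m ρ ρm e b p) {z : E} (hz : z ∈ ball 0 ρm)
    (hc : S.c z = z) : S.c (m z) = m z := by rw [← N.real_m z hz, hc]

theorem norm_Z_m_sub_le (N : S.NormalForm H Z P T m ρ ρm e b p) (hρ : ρm ≤ ρ) {z : E}
    (hz : z ∈ ball 0 ρm) : ‖Z z - Z (m z)‖ ≤ b * e := by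
  have hz' := ball_subset_ball hρ hz
  refine (N.hZ.norm_sub_le (N.maps hz) hz').trans ?_
  rw [norm_sub_rev]
  exact mul_le_mul_of_nonneg_left (N.norm_m_sub_le hz)
    ((norm_nonneg _).trans (N.hZ.bound z hz'))

theorem norm_energy_m_sub_le (N : S.NormalForm H Z P T m ρ ρm e b p) {R : ℝ} (hρ : ρ ≤ R)
    (hρm : ρm ≤ R) {z : E} (hz : z ∈ ball 0 ρm) (hc : S.c z = z) :
    ‖S.energy z - S.energy (m z)‖ ≤ R * e := by
  rw [energy_of_real hc, energy_of_real (N.m_of_real hz hc), ← Complex.ofReal_sub,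
    Complex.norm_real, Real.norm_eq_abs]
  have h1 : |‖z‖ - ‖m z‖| ≤ e := (abs_norm_sub_norm_le _ _).trans
    (by rw [norm_sub_rev]; exact N.norm_m_sub_le hz)
  have h2 : ‖z‖ ≤ R := (mem_ball_zero_iff.1 hz).le.trans hρm
  have h3 : ‖m z‖ ≤ R := (mem_ball_zero_iff.1 (N.maps hz)).le.trans hρ
  have h4 : ‖z‖ ^ 2 / 2 - ‖m z‖ ^ 2 / 2 = (‖z‖ + ‖m z‖) / 2 * (‖z‖ - ‖m z‖) := by ring
  rw [h4, abs_mul, abs_of_nonneg (by positivity)]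
  have := norm_nonneg z
  exact mul_le_mul (by linarith) h1 (abs_nonneg _) (by linarith)

variable [NormedSpace ℝ E] [IsScalarTower ℝ ℂ E]

/-- Stability of the orbits over the time on which the remainder is negligible. -/
theorem stability (N : S.NormalForm H Z P T m ρ ρm e b p) (hH : ∀ z, DifferentiableAt ℂ H z)
    {R δ κ σ τ : ℝ} (hR : 0 < R) (hδ : δ ≤ 1 / 4) (hκ : 0 ≤ κ) (hκδ : 80 * κ < δ)
    (hρ : ρ ≤ R) (hρm : ρm = R * (1 - 2 * δ)) (hρρ : ρm ≤ ρ) (he : e = 8 * κ * R)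
    (hpρ : p * ρ * τ ≤ κ * R ^ 2) (hpb : p * b * τ ≤ 2 * κ ^ 2 * R ^ 2) (hb : b = 2 * κ * R)
    (hp : 0 ≤ p) (hσ : |σ| ≤ 1) {Y : E → E}
    (hY : ∀ z ∈ ball 0 ρm, Y z = σ • S.J (fderiv ℂ H z)) (hYc : ∀ z, Y (S.c z) = S.c (Y z))
    (hYL : ∀ r, ∃ K, LipschitzOnWith K Y (ball 0 r)) {y : ℝ → E}
    (hy : ∀ s ∈ Icc 0 τ, HasDerivWithinAt y (Y (y s)) (Icc 0 τ) s) (hy0 : S.c (y 0) = y 0)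
    (hy0R : ‖y 0‖ < R * (1 - 3 * δ)) :
    ∀ s ∈ Icc 0 τ, ‖y s‖ ≤ R * (1 - 5 / 2 * δ) ∧
      ‖S.energy (y s) - S.energy (y 0)‖ ≤ 17 * κ * R ^ 2 ∧
      ‖Z (y s) - Z (y 0)‖ ≤ 34 * κ ^ 2 * R ^ 2 := by
  have hδ0 : 0 < δ := by linarith
  have hreal := conj_eq_of_hasDerivWithinAt hYc hYL hy hy0
  have hRδ : 0 < R * δ := by positivity
  have hRκ : 80 * (R * κ) < R * δ := by nlinarith
  have hRκ0 : 0 ≤ R * κ := by positivity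
  have h0m : y 0 ∈ ball 0 ρm := by
    rw [mem_ball_zero_iff, hρm]
    linarith
  have hdrift : ∀ s ∈ Icc 0 τ, (∀ u ∈ Icc 0 s, ‖y u‖ ≤ R * (1 - 9 / 4 * δ)) →
      y s ∈ ball 0 ρm ∧ ‖S.energy (m (y s)) - S.energy (m (y 0))‖ ≤ κ * R ^ 2 ∧
        ‖Z (m (y s)) - Z (m (y 0))‖ ≤ 2 * κ ^ 2 * R ^ 2 := by
    intro s hs hu
    have hmem : ∀ u ∈ Icc 0 s, y u ∈ ball 0 ρm := fun u hu' => by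
      rw [mem_ball_zero_iff, hρm]
      linarith [hu u hu']
    have hsub : Icc 0 s ⊆ Icc 0 τ := Icc_subset_Icc_right hs.2
    have hy' : ∀ u ∈ Icc 0 s,
        HasDerivWithinAt y (σ • S.J (fderiv ℂ H (y u))) (Icc 0 s) u := fun u hu' => by
      rw [← hY _ (hmem u hu')]
      exact (hy u (hsub hu')).mono hsub
    have hρ0 : 0 ≤ ρ := (norm_nonneg _).trans (mem_ball_zero_iff.1 (N.maps h0m)).le
    refine ⟨hmem s (right_mem_Icc.2 hs.1), ?_, ?_⟩
    · refine (N.norm_energy_sub_le hH hs.1 hσ hmem hy').trans (le_trans ?_ hpρ)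
      have := hs.2
      gcongr
    · refine (N.norm_Z_sub_le hH hs.1 hσ hmem hy').trans (le_trans ?_ hpb)
      have hb0 : 0 ≤ b := by rw [hb]; positivity
      have := hs.2
      gcongr
  have hyc : ContinuousOn (fun s => ‖y s‖) (Icc 0 τ) :=
    fun s hs => (hy s hs).continuousWithinAt.norm
  -- The radii are nested: the orbit starts within `1 - 3δ`, the improved bound is `1 - 5δ/2`, the
  -- assumed one `1 - 9δ/4`, and `m` is defined within `1 - 2δ`.
  have hbound := forall_le_of_bootstrap (r₁ := R * (1 - 9 / 4 * δ)) (r₂ := R * (1 - 5 / 2 * δ)) hyc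
    (by linarith) (by linarith) fun s hs hu => by
      obtain ⟨hsm, hE, -⟩ := hdrift s hs hu
      rw [energy_of_real (N.m_of_real hsm (hreal s hs)), energy_of_real (N.m_of_real h0m hy0),
        ← Complex.ofReal_sub, Complex.norm_real, Real.norm_eq_abs] at hE
      have h1 := (abs_le.1 hE).2
      have h2 : ‖m (y 0)‖ ≤ R * (1 - 3 * δ) + 8 * (R * κ) := by
        have := norm_sub_norm_le (m (y 0)) (y 0)
        have := N.norm_m_sub_le h0m
        rw [he] at this
        linarith
      have h3 : ‖y s‖ ≤ ‖m (y s)‖ + 8 * (R * κ) := by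
        have := norm_sub_norm_le (y s) (m (y s))
        have h := N.norm_m_sub_le hsm
        rw [he, norm_sub_rev] at h
        linarith
      set x := R * (1 - 3 * δ) + 8 * (R * κ) with hx
      have hx4 : R / 4 ≤ x := by
        have : R * (1 / 4) ≤ R * (1 - 3 * δ) := by gcongr; linarith
        linarith
      have h4 : ‖m (y 0)‖ ^ 2 ≤ x ^ 2 := by gcongr
      -- The squared norm drifts by at most `2κR²`, which the cross term `8xRκ` dominates because `x
      -- ≥ R / 4`; this is where `δ ≤ 1/4` enters.
      have h5 : ‖m (y s)‖ ^ 2 ≤ (x + 4 * (R * κ)) ^ 2 := by nlinarith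
      have h6 : ‖m (y s)‖ ≤ x + 4 * (R * κ) := by
        refine le_of_sq_le_sq h5 ?_
        linarith
      linarith
  intro s hs
  obtain ⟨hsm, hE, hZ⟩ := hdrift s hs fun u hu =>
    (hbound u ⟨hu.1, hu.2.trans hs.2⟩).trans (by linarith)
  refine ⟨hbound s hs, ?_, ?_⟩
  · have hρmR : ρm ≤ R := hρρ.trans hρ
    have h1 := N.norm_energy_m_sub_le hρ hρmR hsm (hreal s hs)
    have h2 := N.norm_energy_m_sub_le hρ hρmR h0m hy0
    rw [norm_sub_rev] at h2
    rw [he] at h1 h2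
    calc _ = ‖(S.energy (y s) - S.energy (m (y s))) + (S.energy (m (y s)) - S.energy (m (y 0)))
          + (S.energy (m (y 0)) - S.energy (y 0))‖ := by congr 1; ring
      _ ≤ _ := norm_add₃_le
      -- The constant 17 is `8 + 1 + 8`: two coordinate changes and the drift.
      _ ≤ _ := by linarith
  · have h1 := N.norm_Z_m_sub_le hρρ hsm
    have h2 := N.norm_Z_m_sub_le hρρ h0m
    rw [norm_sub_rev] at h2
    rw [he, hb] at h1 h2
    calc _ = ‖(Z (y s) - Z (m (y s))) + (Z (m (y s)) - Z (m (y 0)))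
          + (Z (m (y 0)) - Z (y 0))‖ := by congr 1; ring
      _ ≤ _ := norm_add₃_le
      _ ≤ _ := by linarith

end NormalForm

end OscillatorSpace

/-! ### Cutoff fields and global existence -/

section Cutoff

variable {E : Type*} [NormedAddCommGroup E] [NormedSpace ℝ E]

/-- A field multiplied by a radial cutoff. -/
def cutoff (r : ℝ) (X : E → E) (z : E) : E := (max 0 (min 1 (r + 1 - ‖z‖)) : ℝ) • X z

theorem cutoff_eq {r : ℝ} {X : E → E} {z : E} (hz : ‖z‖ ≤ r) : cutoff r X z = X z := by
  rw [cutoff, min_eq_left (by linarith), max_eq_right zero_le_one, one_smul]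

theorem cutoff_eq_zero {r : ℝ} {X : E → E} {z : E} (hz : r + 1 ≤ ‖z‖) : cutoff r X z = 0 := by
  rw [cutoff, max_eq_left (min_le_of_right_le (by linarith)), zero_smul]

theorem norm_cutoff_le {r : ℝ} {X : E → E} {L : ℝ} (hL : ∀ z ∈ ball 0 (r + 1), ‖X z‖ ≤ L)
    (hL0 : 0 ≤ L) (z : E) : ‖cutoff r X z‖ ≤ L := by
  rcases lt_or_ge ‖z‖ (r + 1) with hz | hz
  · rw [cutoff, norm_smul, Real.norm_of_nonneg (le_max_left _ _)]
    have h1 : max 0 (min 1 (r + 1 - ‖z‖)) ≤ 1 := max_le zero_le_one (min_le_left _ _)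
    calc _ ≤ 1 * ‖X z‖ := by gcongr
      _ ≤ L := by rw [one_mul]; exact hL z (mem_ball_zero_iff.2 hz)
  · rwa [cutoff_eq_zero hz, norm_zero]

theorem abs_cutoff_sub_le (r a b : ℝ) :
    |max 0 (min 1 (r + 1 - a)) - max 0 (min 1 (r + 1 - b))| ≤ |a - b| := by
  refine (abs_max_sub_max_le_max _ _ _ _).trans (max_le (by simp) ?_)
  refine (abs_min_sub_min_le_max _ _ _ _).trans (max_le (by simp) ?_)
  rw [sub_sub_sub_cancel_left, abs_sub_comm]

theorem lipschitzWith_cutoff {r : ℝ} {X : E → E} {L : ℝ} {K : NNReal}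
    (hL : ∀ z ∈ ball 0 (r + 1), ‖X z‖ ≤ L) (hL0 : 0 ≤ L)
    (hK : LipschitzOnWith K X (ball 0 (r + 1))) :
    LipschitzWith (L.toNNReal + K) (cutoff r X) := by
  -- Only one point has to lie in the support: if the other is outside, its cutoff factor vanishes
  -- and the Lipschitz bound of the factor alone suffices.
  have key : ∀ x y : E, ‖x‖ < r + 1 → ‖cutoff r X x - cutoff r X y‖ ≤ (L + K) * ‖x - y‖ := by
    intro x y hx
    have hXx := hL x (mem_ball_zero_iff.2 hx)
    rcases lt_or_ge ‖y‖ (r + 1) with hy | hy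
    · set a := max 0 (min 1 (r + 1 - ‖x‖))
      set b := max 0 (min 1 (r + 1 - ‖y‖))
      have hb0 : 0 ≤ b := le_max_left _ _
      have hb1 : b ≤ 1 := max_le zero_le_one (min_le_left _ _)
      have hab : |a - b| ≤ ‖x - y‖ :=
        (abs_cutoff_sub_le r _ _).trans (abs_norm_sub_norm_le _ _)
      have heq : cutoff r X x - cutoff r X y = (a - b) • X x + b • (X x - X y) := by
        simp only [cutoff, a, b]
        module
      have hd := hK.dist_le_mul x (mem_ball_zero_iff.2 hx) y (mem_ball_zero_iff.2 hy)
      rw [dist_eq_norm, dist_eq_norm] at hd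
      rw [heq]
      refine (norm_add_le _ _).trans ?_
      rw [norm_smul, norm_smul, Real.norm_eq_abs, Real.norm_of_nonneg hb0]
      have h1 : |a - b| * ‖X x‖ ≤ ‖x - y‖ * L := by gcongr
      have h2 : b * ‖X x - X y‖ ≤ 1 * ‖X x - X y‖ := by gcongr
      linarith
    · have hb : max 0 (min 1 (r + 1 - ‖y‖)) = 0 :=
        max_eq_left (min_le_of_right_le (by linarith))
      have h1 := abs_cutoff_sub_le r ‖x‖ ‖y‖
      rw [hb, sub_zero] at h1
      rw [cutoff_eq_zero hy, sub_zero, cutoff, norm_smul, Real.norm_eq_abs]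
      have h2 := h1.trans (abs_norm_sub_norm_le x y)
      have h3 : |max 0 (min 1 (r + 1 - ‖x‖))| * ‖X x‖ ≤ ‖x - y‖ * L := by gcongr
      nlinarith [K.2, norm_nonneg (x - y), mul_nonneg K.2 (norm_nonneg (x - y))]
  refine LipschitzWith.of_dist_le_mul fun x y => ?_
  rw [dist_eq_norm, dist_eq_norm, NNReal.coe_add, Real.coe_toNNReal _ hL0]
  rcases lt_or_ge ‖x‖ (r + 1) with hx | hx
  · exact key x y hx
  · rcases lt_or_ge ‖y‖ (r + 1) with hy | hy
    · rw [norm_sub_rev, norm_sub_rev x]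
      exact key y x hy
    · rw [cutoff_eq_zero hx, cutoff_eq_zero hy, sub_zero, norm_zero]
      positivity

/-- A bounded globally Lipschitz field has solutions on any time interval. -/
theorem exists_solution_of_lipschitzWith [CompleteSpace E] {Y : E → E} {L K : NNReal}
    (hK : LipschitzWith K Y) (hL : ∀ z, ‖Y z‖ ≤ L) {τ : ℝ} (hτ : 0 ≤ τ) (z₀ : E) :
    ∃ y : ℝ → E, y 0 = z₀ ∧ ∀ t ∈ Icc (-τ) τ, HasDerivWithinAt y (Y (y t)) (Icc (-τ) τ) t := by
  have hPL : IsPicardLindelof (fun _ => Y) (tmin := -τ) (tmax := τ)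
      ⟨0, by constructor <;> linarith⟩ z₀ (L * τ.toNNReal) 0 L K :=
    IsPicardLindelof.of_time_independent (fun z _ => hL z) hK.lipschitzOnWith
      (by simp [Real.coe_toNNReal _ hτ])
  exact hPL.exists_eq_forall_mem_Icc_hasDerivWithinAt₀

end Cutoff

end HolomorphicNormalForm

/-! ### Bilinear pairing, shifts and pointwise powers on `ℓ²` -/

namespace KleinGordon

open Metric Filter Topology ComplexConjugate HolomorphicNormalForm

variable {d : ℕ}

section Sequences

theorem norm_le_of_forall_norm_le {x y : Seq d} {C : ℝ} (hC : 0 ≤ C)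
    (h : ∀ j, ‖x j‖ ≤ C * ‖y j‖) : ‖x‖ ≤ C * ‖y‖ := by
  refine lp.norm_le_of_forall_sum_le (by norm_num) (by positivity) fun s => ?_
  have h2 := lp.sum_rpow_le_norm_rpow (p := 2) (by norm_num) y s
  norm_num at h2 ⊢
  calc ∑ i ∈ s, ‖x i‖ ^ 2 ≤ ∑ i ∈ s, C ^ 2 * ‖y i‖ ^ 2 := by
        refine Finset.sum_le_sum fun i _ => ?_
        rw [← mul_pow]
        exact pow_le_pow_left₀ (norm_nonneg _) (h i) 2
    _ = C ^ 2 * ∑ i ∈ s, ‖y i‖ ^ 2 := by rw [Finset.mul_sum]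
    _ ≤ (C * ‖y‖) ^ 2 := by rw [mul_pow]; gcongr

theorem norm_coord_le (x : Seq d) (j : Fin d → ℤ) : ‖x j‖ ≤ ‖x‖ :=
  lp.norm_apply_le_norm (by norm_num) x j

theorem norm_mul_le_coe_one : ‖ContinuousLinearMap.mul ℂ ℂ‖ ≤ ((1 : NNReal) : ℝ) := by
  simp

/-- The bilinear pairing `∑ x_j y_j`. -/
def pair : Seq d →L[ℂ] Seq d →L[ℂ] ℂ :=
  lp.dualPairing 2 2 (fun _ => ContinuousLinearMap.mul ℂ ℂ) fun _ => norm_mul_le_coe_one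

theorem pair_apply (x y : Seq d) : pair x y = ∑' j, x j * y j := rfl

theorem pair_eq_inner (x y : Seq d) : pair x y = inner ℂ (star x) y := by
  rw [pair_apply, lp.inner_eq_tsum]
  refine tsum_congr fun j => ?_
  simp [mul_comm]

theorem summable_pair (x y : Seq d) : Summable fun j => x j * y j := by
  refine (lp.summable_inner (𝕜 := ℂ) (star x) y).congr fun j => ?_
  simp [mul_comm]

theorem norm_pair_le (x y : Seq d) : ‖pair x y‖ ≤ ‖x‖ * ‖y‖ := by
  rw [pair_eq_inner]
  simpa using norm_inner_le_norm (𝕜 := ℂ) (star x) y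

theorem pair_comm (x y : Seq d) : pair x y = pair y x := by
  simp only [pair_apply, mul_comm]

theorem pair_star (x y : Seq d) : pair (star x) (star y) = conj (pair x y) := by
  simp [pair_apply, Complex.conj_tsum]

theorem pair_self_of_real {x : Seq d} (hx : star x = x) : pair x x = ((‖x‖ ^ 2 : ℝ) : ℂ) := by
  rw [pair_eq_inner, hx, inner_self_eq_norm_sq_to_K]
  norm_cast

/-- Pointwise multiplication on `ℓ²`. -/
def mulSeq : Seq d →L[ℂ] Seq d →L[ℂ] Seq d :=
  (LinearMap.mk₂ ℂ (fun x y : Seq d => (⟨fun j => x j * y j,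
      ((lp.memℓp y).norm.const_mul ‖x‖).mono fun j => by
        rw [norm_mul]
        exact mul_le_mul_of_nonneg_right (norm_coord_le x j) (norm_nonneg _)⟩ : Seq d))
    (fun x x' y => by ext j; exact add_mul _ _ _) (fun a x y => by ext j; simp [mul_assoc])
    (fun x y y' => by ext j; exact mul_add _ _ _)
    (fun a x y => by ext j; simp [mul_left_comm])).mkContinuous₂ 1 fun x y => by
      rw [one_mul]
      refine norm_le_of_forall_norm_le (norm_nonneg x) fun j => ?_
      simp only [LinearMap.mk₂_apply, norm_mul]
      exact mul_le_mul_of_nonneg_right (norm_coord_le x j) (norm_nonneg _)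

theorem mulSeq_apply (x y : Seq d) (j : Fin d → ℤ) : mulSeq x y j = x j * y j := rfl

/-- Translation on the lattice. -/
def shift (k : Fin d → ℤ) : Seq d →L[ℂ] Seq d :=
  LinearMap.mkContinuous
    { toFun := fun x => (⟨fun j => x (j + k), by
        have h := (memℓp_gen_iff (by norm_num)).1 (lp.memℓp x)
        refine (memℓp_gen_iff (by norm_num)).2 ?_
        exact h.comp_injective (add_left_injective k)⟩ : Seq d)
      map_add' := fun x y => rfl
      map_smul' := fun a x => by ext j; simp } 1 fun x => by
    rw [one_mul]
    refine lp.norm_le_of_forall_sum_le (by norm_num) (norm_nonneg x) fun s => ?_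
    have h2 := lp.sum_rpow_le_norm_rpow (p := 2) (by norm_num) x
      (s.map (addRightEmbedding k))
    rw [Finset.sum_map] at h2
    exact h2

/-- The difference `x_j - x_{j+k}`. -/
def diffSeq (k : Fin d → ℤ) : Seq d →L[ℂ] Seq d := ContinuousLinearMap.id ℂ _ - shift k

theorem diffSeq_apply (k : Fin d → ℤ) (x : Seq d) (j : Fin d → ℤ) :
    diffSeq k x j = x j - x (j + k) := rfl

theorem norm_shift_le (k : Fin d → ℤ) (x : Seq d) : ‖shift k x‖ ≤ ‖x‖ := by
  have h := (shift k).le_of_opNorm_le (LinearMap.mkContinuous_norm_le _ zero_le_one _) x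
  rwa [one_mul] at h

theorem norm_diffSeq_le (k : Fin d → ℤ) (x : Seq d) : ‖diffSeq k x‖ ≤ 2 * ‖x‖ :=
  calc ‖x - shift k x‖ ≤ ‖x‖ + ‖shift k x‖ := norm_sub_le _ _
    _ ≤ 2 * ‖x‖ := by linarith [norm_shift_le k x]

/-- The pointwise power `x_j ^ (n + 1)`. -/
def powSeq : ℕ → Seq d → Seq d
  | 0, x => x
  | n + 1, x => mulSeq (powSeq n x) x

theorem powSeq_apply (n : ℕ) (x : Seq d) (j : Fin d → ℤ) : powSeq n x j = x j ^ (n + 1) := by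
  induction n with
  | zero => simp [powSeq]
  | succ n ih => rw [powSeq, mulSeq_apply, ih, pow_succ _ (n + 1)]

/-- Each coordinate is bounded by the `ℓ²` norm, so all factors but one are estimated in the
supremum norm. -/
theorem norm_powSeq_le (n : ℕ) (x : Seq d) : ‖powSeq n x‖ ≤ ‖x‖ ^ (n + 1) := by
  rw [pow_succ]
  refine norm_le_of_forall_norm_le (by positivity) fun j => ?_
  rw [powSeq_apply, norm_pow, pow_succ]
  have := norm_coord_le x j
  gcongr

/-- The derivative of `powSeq n`. -/
def powSeqDeriv : ℕ → Seq d → Seq d →L[ℂ] Seq d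
  | 0, _ => ContinuousLinearMap.id ℂ _
  | n + 1, x => mulSeq (powSeq n x) + (mulSeq.flip x).comp (powSeqDeriv n x)

theorem hasFDerivAt_powSeq (n : ℕ) (x : Seq d) :
    HasFDerivAt (powSeq n) (powSeqDeriv n x) x := by
  induction n with
  | zero => exact hasFDerivAt_id x
  | succ n ih =>
    have h : HasFDerivAt (powSeq (n + 1)) _ x :=
      (mulSeq.hasFDerivAt.comp x ih).clm_apply (hasFDerivAt_id x)
    refine h.congr_fderiv ?_
    ext k j
    simp [powSeqDeriv, mulSeq_apply]

theorem powSeqDeriv_apply (n : ℕ) (x h : Seq d) (j : Fin d → ℤ) :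
    powSeqDeriv n x h j = (n + 1) * (x j ^ n * h j) := by
  induction n with
  | zero => simp [powSeqDeriv]
  | succ n ih =>
    simp only [powSeqDeriv, add_apply, ContinuousLinearMap.comp_apply,
      ContinuousLinearMap.flip_apply, lp.coeFn_add, Pi.add_apply, mulSeq_apply, powSeq_apply, ih]
    push_cast
    ring

theorem hasFDerivAt_pair_powSeq (n : ℕ) (x : Seq d) :
    HasFDerivAt (fun x : Seq d => pair (powSeq n x) x) ((n + 2 : ℂ) • pair (powSeq n x)) x := by
  have h := (pair.hasFDerivAt.comp x (hasFDerivAt_powSeq n x)).clm_apply (hasFDerivAt_id x)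
  refine HasFDerivAt.congr_fderiv h ?_
  ext k
  simp only [add_apply, smul_apply, ContinuousLinearMap.comp_apply,
    ContinuousLinearMap.flip_apply, ContinuousLinearMap.id_apply, id_eq, Function.comp_apply,
    smul_eq_mul]
  have : pair (powSeqDeriv n x k) x = (n + 1) * pair (powSeq n x) k := by
    rw [pair_apply, pair_apply, ← tsum_mul_left]
    refine tsum_congr fun j => ?_
    rw [powSeqDeriv_apply, powSeq_apply]
    ring
  rw [this]
  ring

theorem hasFDerivAt_pair_diffSeq (k : Fin d → ℤ) (x : Seq d) :
    HasFDerivAt (fun x : Seq d => pair (diffSeq k x) (diffSeq k x))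
      ((2 : ℂ) • (pair (diffSeq k x)).comp (diffSeq k)) x := by
  have h := (pair.hasFDerivAt.comp x (diffSeq k).hasFDerivAt).clm_apply
    ((diffSeq k).hasFDerivAt (x := x))
  refine HasFDerivAt.congr_fderiv h ?_
  ext h
  simp only [add_apply, smul_apply, ContinuousLinearMap.comp_apply,
    ContinuousLinearMap.flip_apply, Function.comp_apply, smul_eq_mul]
  rw [pair_comm (diffSeq k h)]
  ring

theorem powSeq_star (n : ℕ) (x : Seq d) : powSeq n (star x) = star (powSeq n x) := by
  ext j
  simp [powSeq_apply]

theorem diffSeq_star (k : Fin d → ℤ) (x : Seq d) : diffSeq k (star x) = star (diffSeq k x) := by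
  ext j
  simp [diffSeq_apply]

end Sequences

end KleinGordon

/-! ### The lattice phase space as an oscillator space -/

namespace KleinGordon

open Metric Filter Topology ComplexConjugate HolomorphicNormalForm

variable {d : ℕ}

section PhaseSpace

theorem phase_ext {z w : Phase d} (h₁ : z.fst = w.fst) (h₂ : z.snd = w.snd) : z = w :=
  WithLp.ofLp_injective 2 (Prod.ext h₁ h₂)

theorem norm_sq_phase (z : Phase d) : ‖z‖ ^ 2 = ‖z.fst‖ ^ 2 + ‖z.snd‖ ^ 2 :=
  WithLp.prod_norm_sq_eq_of_L2 z

theorem norm_fst_le (z : Phase d) : ‖z.fst‖ ≤ ‖z‖ :=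
  le_of_sq_le_sq (by rw [norm_sq_phase]; linarith [sq_nonneg ‖z.snd‖]) (norm_nonneg _)

/-- The projection to the positions. -/
def fstL : Phase d →L[ℂ] Seq d := WithLp.fstL 2 ℂ _ _

/-- The projection to the momenta. -/
def sndL : Phase d →L[ℂ] Seq d := WithLp.sndL 2 ℂ _ _

/-- The symplectic form as a continuous bilinear map. -/
def symplL : Phase d →L[ℂ] Phase d →L[ℂ] ℂ :=
  pair.bilinearComp fstL sndL - pair.bilinearComp sndL fstL

theorem symplL_apply (z w : Phase d) :
    symplL z w = pair z.fst w.snd - pair z.snd w.fst := rfl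

theorem sympl_eq (z w : Phase d) : sympl z w = symplL z w := by
  rw [symplL_apply, pair_apply, pair_apply,
    ← (summable_pair _ _).tsum_sub (summable_pair _ _)]
  rfl

/-- Complex conjugation on the phase space. -/
def conjL : Phase d →L⋆[ℂ] Phase d :=
  LinearMap.mkContinuous
    { toFun := fun z => WithLp.toLp 2 (star z.fst, star z.snd)
      map_add' := fun z w => phase_ext (by simp) (by simp)
      map_smul' := fun a z => phase_ext (by simp [star_smul]) (by simp [star_smul]) } 1 fun z => by
    refine le_of_sq_le_sq ?_ (by positivity)
    rw [one_mul, norm_sq_phase, norm_sq_phase]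
    simp

theorem conjL_fst (z : Phase d) : (conjL z).fst = star z.fst := rfl

theorem conjL_snd (z : Phase d) : (conjL z).snd = star z.snd := rfl

theorem conjL_eq_iff (z : Phase d) : conjL z = z ↔ IsReal z := by
  constructor
  · intro h j
    have h1 := congrArg (fun w : Phase d => w.fst j) h
    have h2 := congrArg (fun w : Phase d => w.snd j) h
    exact ⟨Complex.conj_eq_iff_im.1 h1, Complex.conj_eq_iff_im.1 h2⟩
  · intro h
    refine phase_ext ?_ ?_
    · ext j
      exact Complex.conj_eq_iff_im.2 (h j).1
    · ext j
      exact Complex.conj_eq_iff_im.2 (h j).2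

/-- The vector field `(v, -u)` of the harmonic oscillators. -/
def oscL : Phase d →L[ℂ] Phase d :=
  (WithLp.prodContinuousLinearEquiv 2 ℂ (Seq d) (Seq d)).symm.toContinuousLinearMap.comp
    (sndL.prod (-fstL))

theorem oscL_fst (z : Phase d) : (oscL z).fst = z.snd := rfl

theorem oscL_snd (z : Phase d) : (oscL z).snd = -z.fst := rfl

theorem norm_conjL (z : Phase d) : ‖conjL z‖ = ‖z‖ := by
  refine (sq_eq_sq₀ (norm_nonneg _) (norm_nonneg _)).1 ?_
  rw [norm_sq_phase, norm_sq_phase, conjL_fst, conjL_snd, norm_star, norm_star]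

theorem norm_oscL (z : Phase d) : ‖oscL z‖ = ‖z‖ := by
  refine (sq_eq_sq₀ (norm_nonneg _) (norm_nonneg _)).1 ?_
  rw [norm_sq_phase, norm_sq_phase, oscL_fst, oscL_snd, norm_neg, add_comm]

/-- The Hamiltonian vector with a given differential. -/
def hamVec : (Phase d →L[ℂ] ℂ) →L[ℂ] Phase d :=
  oscL.comp (conjL.comp
    (InnerProductSpace.toDual ℂ (Phase d)).symm.toContinuousLinearEquiv.toContinuousLinearMap)

theorem hamVec_apply (l : Phase d →L[ℂ] ℂ) :
    hamVec l = oscL (conjL ((InnerProductSpace.toDual ℂ (Phase d)).symm l)) := rfl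

theorem hamField_eq (f : Phase d → ℂ) (z : Phase d) : hamField f z = hamVec (fderiv ℂ f z) := rfl

theorem norm_hamVec (l : Phase d →L[ℂ] ℂ) : ‖hamVec l‖ = ‖l‖ := by
  rw [hamVec_apply, norm_oscL, norm_conjL, LinearIsometryEquiv.norm_map]

theorem norm_sq_real_combination (u v : Seq d) (a b : ℝ) :
    ‖(a : ℂ) • u + (b : ℂ) • v‖ ^ 2
      = a ^ 2 * ‖u‖ ^ 2 + 2 * (a * b * (inner ℂ u v).re) + b ^ 2 * ‖v‖ ^ 2 := by
  rw [norm_add_sq (𝕜 := ℂ), norm_smul, norm_smul, inner_smul_left, inner_smul_right,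
    Complex.conj_ofReal, Complex.norm_real, Complex.norm_real, mul_pow, mul_pow, Real.norm_eq_abs,
    Real.norm_eq_abs, sq_abs, sq_abs]
  simp [mul_assoc]

/-- The phase space of the Klein-Gordon lattice with its harmonic oscillators. -/
def phaseSpace (d : ℕ) : OscillatorSpace (Phase d) where
  ω := symplL
  J := hamVec
  A := oscL
  c := conjL
  ω_antisymm x y := by
    rw [symplL_apply, symplL_apply, pair_comm x.fst, pair_comm x.snd]
    ring
  ω_J l x := by
    have h : l x = inner ℂ ((InnerProductSpace.toDual ℂ (Phase d)).symm l) x := by simp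
    rw [h, symplL_apply, hamVec_apply, WithLp.prod_inner_apply]
    rw [oscL_fst, oscL_snd, map_neg, neg_apply, conjL_fst, conjL_snd, pair_eq_inner,
      pair_eq_inner, star_star, star_star, sub_neg_eq_add, add_comm]
    rfl
  norm_J l := (norm_hamVec l).le
  J_conj l l' h := by
    set w := (InnerProductSpace.toDual ℂ (Phase d)).symm l with hw
    have hw' : (InnerProductSpace.toDual ℂ (Phase d)).symm l' = conjL w := by
      rw [LinearIsometryEquiv.symm_apply_eq]
      ext x
      have h1 : l (conjL x) = inner ℂ w (conjL x) := by simp [hw]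
      rw [h x, h1, InnerProductSpace.toDual_apply_apply, WithLp.prod_inner_apply,
        WithLp.prod_inner_apply, map_add]
      congr 1
      · have := pair_star (star w.fst) (star x.fst)
        rw [star_star, star_star, pair_eq_inner, pair_eq_inner, star_star] at this
        exact this.symm
      · have := pair_star (star w.snd) (star x.snd)
        rw [star_star, star_star, pair_eq_inner, pair_eq_inner, star_star] at this
        exact this.symm
    rw [hamVec_apply, hamVec_apply, hw', ← hw]
    refine phase_ext rfl ?_
    rw [conjL_snd, oscL_snd, oscL_snd, star_neg, conjL_fst]
  ω_c x y := by
    simp only [symplL_apply, conjL_fst, conjL_snd, pair_star, map_sub]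
  A_A x := phase_ext (by simp [oscL_fst, oscL_snd]) (by simp [oscL_fst, oscL_snd])
  ω_A x y := by
    rw [symplL_apply, symplL_apply]
    simp only [oscL_fst, oscL_snd, map_neg, neg_apply]
    rw [pair_comm x.snd, pair_comm x.fst]
  norm_rot t x := by
    have h : ‖(Real.cos t : ℂ) • x + (Real.sin t : ℂ) • oscL x‖ ^ 2 = ‖x‖ ^ 2 := by
      rw [norm_sq_phase, norm_sq_phase x]
      have h1 : ((Real.cos t : ℂ) • x + (Real.sin t : ℂ) • oscL x).fst
          = (Real.cos t : ℂ) • x.fst + (Real.sin t : ℂ) • x.snd := by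
        simp [oscL_fst]
      have h2 : ((Real.cos t : ℂ) • x + (Real.sin t : ℂ) • oscL x).snd
          = (Real.cos t : ℂ) • x.snd + ((-Real.sin t : ℝ) : ℂ) • x.fst := by
        simp [oscL_snd]
      -- The two cross terms have opposite coefficients and inner products with equal real parts, so
      -- they cancel even for complex sequences.
      rw [h1, h2, norm_sq_real_combination, norm_sq_real_combination,
        ← inner_conj_symm x.snd x.fst, Complex.conj_re]
      have := Real.sin_sq_add_cos_sq t
      linear_combination (‖x.fst‖ ^ 2 + ‖x.snd‖ ^ 2) * this
    exact (sq_eq_sq₀ (norm_nonneg _) (norm_nonneg _)).1 h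
  c_c x := phase_ext (by simp [conjL_fst]) (by simp [conjL_snd])
  norm_c := norm_conjL
  A_c x := phase_ext rfl (by simp [oscL_snd, conjL_snd, conjL_fst])
  ω_A_self x hx := by
    have h1 : star x.fst = x.fst := congrArg WithLp.fst hx
    have h2 : star x.snd = x.snd := congrArg WithLp.snd hx
    rw [symplL_apply, oscL_fst, oscL_snd, map_neg, neg_apply, pair_self_of_real h1,
      pair_self_of_real h2, norm_sq_phase]
    push_cast
    ring

end PhaseSpace

end KleinGordon

/-! ### The Klein-Gordon Hamiltonians: gradients and lower bounds -/

namespace HolomorphicNormalForm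

open Metric Filter Topology ComplexConjugate

theorem OscillatorSpace.isHamiltonian_energy {E : Type*} [NormedAddCommGroup E] [NormedSpace ℂ E]
    (S : OscillatorSpace E) (r : ℝ) : S.IsHamiltonian r (‖S.ω‖ * r) S.energy where
  holo z _ := (OscillatorSpace.hasFDerivAt_energy z).differentiableAt.differentiableWithinAt
  bound z hz := by
    rw [(OscillatorSpace.hasFDerivAt_energy z).fderiv]
    refine (S.ω.le_opNorm _).trans ?_
    rw [S.norm_A]
    have := (mem_ball_zero_iff.1 hz).le
    gcongr
  real z _ := by
    rw [OscillatorSpace.energy, S.A_c, S.ω_c, OscillatorSpace.energy, map_div₀, map_ofNat]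

end HolomorphicNormalForm

namespace KleinGordon

open Metric Filter Topology ComplexConjugate HolomorphicNormalForm

variable {d : ℕ}

theorem G_eq_energy : (G : Phase d → ℂ) = (phaseSpace d).energy := by
  ext z
  have h : (phaseSpace d).energy z = (pair z.snd z.snd - pair (-z.fst) z.fst) / 2 := rfl
  rw [h, map_neg, neg_apply, sub_neg_eq_add, pair_apply, pair_apply,
    ← (summable_pair _ _).tsum_add (summable_pair _ _), G]
  have h2 : ∀ j, posCoord z j ^ 2 + momCoord z j ^ 2 = z.snd j * z.snd j + z.fst j * z.fst j :=
    fun j => by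
      simp only [posCoord, momCoord]
      ring
  rw [tsum_congr h2]
  ring

/-- The coupling energy of the bonds in the direction `k`. -/
def bondEnergy (k : Fin d → ℤ) (x : Seq d) : ℂ := pair (diffSeq k x) (diffSeq k x)

theorem F_eq (p : ℕ) (ε : ℝ) (z : Phase d) :
    F p ε z = (ε : ℂ) / (2 * (p : ℂ) + 2) * pair (powSeq (2 * p) z.fst) z.fst +
      (ε : ℂ) / 2 * ∑ i : Fin d, (bondEnergy (unitVec i) z.fst + bondEnergy (-unitVec i) z.fst) := by
  rw [F]
  congr 2
  · rw [pair_apply]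
    refine tsum_congr fun j => ?_
    rw [powSeq_apply, posCoord]
    ring
  · have hs : ∀ k : Fin d → ℤ, Summable fun j => (posCoord z j - posCoord z (j + k)) ^ 2 :=
      fun k => (summable_pair (diffSeq k z.fst) (diffSeq k z.fst)).congr fun j => by
        rw [diffSeq_apply, posCoord, posCoord]
        ring
    have ht : ∀ k : Fin d → ℤ, ∑' j, (posCoord z j - posCoord z (j + k)) ^ 2
        = bondEnergy k z.fst := fun k => by
      rw [bondEnergy, pair_apply]
      refine tsum_congr fun j => ?_
      rw [diffSeq_apply, posCoord, posCoord]
      ring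
    simp only [sub_eq_add_neg (_ : Fin d → ℤ)]
    rw [Summable.tsum_finsetSum fun i _ => (hs _).add (hs _)]
    refine Finset.sum_congr rfl fun i _ => ?_
    rw [(hs _).tsum_add (hs _), ht, ht]

/-- The differential of `F` with respect to the positions. -/
def derivF (p : ℕ) (ε : ℝ) (x : Seq d) : Seq d →L[ℂ] ℂ :=
  (ε : ℂ) • pair (powSeq (2 * p) x) + ((ε : ℂ) / 2) • ∑ i : Fin d,
    ((2 : ℂ) • (pair (diffSeq (unitVec i) x)).comp (diffSeq (unitVec i)) +
      (2 : ℂ) • (pair (diffSeq (-unitVec i) x)).comp (diffSeq (-unitVec i)))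

theorem hasFDerivAt_F (p : ℕ) (ε : ℝ) (z : Phase d) :
    HasFDerivAt (F p ε) ((derivF p ε z.fst).comp fstL) z := by
  have h1 : HasFDerivAt (fun x : Seq d => (ε : ℂ) / (2 * (p : ℂ) + 2) * pair (powSeq (2 * p) x) x +
      (ε : ℂ) / 2 * ∑ i : Fin d, (bondEnergy (unitVec i) x + bondEnergy (-unitVec i) x))
      (derivF p ε z.fst) z.fst := by
    have hp : (2 * (p : ℂ) + 2) ≠ 0 := by
      exact_mod_cast (by positivity : (2 * p + 2) ≠ 0)
    have hpow := (hasFDerivAt_pair_powSeq (2 * p) z.fst).const_mul ((ε : ℂ) / (2 * (p : ℂ) + 2))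
    have hsum := (HasFDerivAt.fun_sum (u := (Finset.univ : Finset (Fin d))) fun i _ =>
      (hasFDerivAt_pair_diffSeq (unitVec i) z.fst).add
        (hasFDerivAt_pair_diffSeq (-unitVec i) z.fst)).const_mul ((ε : ℂ) / 2)
    refine (hpow.add hsum).congr_fderiv ?_
    rw [derivF, smul_smul]
    congr 2
    push_cast
    field_simp
  have h2 : F p ε = fun z : Phase d => (fun x : Seq d => (ε : ℂ) / (2 * (p : ℂ) + 2) *
      pair (powSeq (2 * p) x) x + (ε : ℂ) / 2 *
        ∑ i : Fin d, (bondEnergy (unitVec i) x + bondEnergy (-unitVec i) x)) (fstL z) := by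
    ext z
    exact F_eq p ε z
  rw [h2]
  exact HasFDerivAt.comp z h1 fstL.hasFDerivAt

theorem norm_derivF_le (p : ℕ) {ε : ℝ} (hε : 0 ≤ ε) (x : Seq d) :
    ‖derivF p ε x‖ ≤ ε * (‖x‖ ^ (2 * p + 1) + 8 * d * ‖x‖) := by
  refine ContinuousLinearMap.opNorm_le_bound _ (by positivity) fun h => ?_
  have hb : ∀ k : Fin d → ℤ, ‖(2 : ℂ) * pair (diffSeq k x) (diffSeq k h)‖ ≤ 8 * (‖x‖ * ‖h‖) := by
    intro k
    rw [norm_mul, Complex.norm_ofNat]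
    have h1 := norm_pair_le (diffSeq k x) (diffSeq k h)
    have h2 : ‖diffSeq k x‖ * ‖diffSeq k h‖ ≤ (2 * ‖x‖) * (2 * ‖h‖) :=
      mul_le_mul (norm_diffSeq_le k x) (norm_diffSeq_le k h) (norm_nonneg _) (by positivity)
    linarith
  have hs : ‖∑ i : Fin d, ((2 : ℂ) * pair (diffSeq (unitVec i) x) (diffSeq (unitVec i) h) +
      (2 : ℂ) * pair (diffSeq (-unitVec i) x) (diffSeq (-unitVec i) h))‖
      ≤ d * (16 * (‖x‖ * ‖h‖)) := by
    refine (norm_sum_le _ _).trans ((Finset.sum_le_card_nsmul _ _ (16 * (‖x‖ * ‖h‖)) fun i _ =>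
      (norm_add_le _ _).trans ?_).trans ?_)
    · linarith [hb (unitVec i), hb (-unitVec i)]
    · simp
  have hp : ‖pair (powSeq (2 * p) x) h‖ ≤ ‖x‖ ^ (2 * p + 1) * ‖h‖ :=
    (norm_pair_le _ _).trans (mul_le_mul_of_nonneg_right (norm_powSeq_le _ _) (norm_nonneg _))
  have heq : derivF p ε x h = (ε : ℂ) * pair (powSeq (2 * p) x) h + ((ε : ℂ) / 2) *
      ∑ i : Fin d, ((2 : ℂ) * pair (diffSeq (unitVec i) x) (diffSeq (unitVec i) h) +
        (2 : ℂ) * pair (diffSeq (-unitVec i) x) (diffSeq (-unitVec i) h)) := by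
    simp [derivF]
  rw [heq]
  have hε1 : ‖(ε : ℂ)‖ = ε := by rw [Complex.norm_real, Real.norm_of_nonneg hε]
  have hε2 : ‖(ε : ℂ) / 2‖ = ε / 2 := by rw [norm_div, hε1, Complex.norm_ofNat]
  refine (norm_add_le _ _).trans ?_
  rw [norm_mul, norm_mul, hε1, hε2]
  have h1 := mul_le_mul_of_nonneg_left hp hε
  have h2 := mul_le_mul_of_nonneg_left hs (by positivity : 0 ≤ ε / 2)
  linarith

theorem F_conj (p : ℕ) (ε : ℝ) (z : Phase d) : F p ε (conjL z) = conj (F p ε z) := by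
  simp only [F_eq, bondEnergy, conjL_fst, diffSeq_star, powSeq_star, pair_star, map_add, map_mul,
    map_div₀, map_sum, Complex.conj_ofReal, map_ofNat, map_natCast]

theorem isHamiltonian_F (p : ℕ) {ε : ℝ} (hε : 0 ≤ ε) {r : ℝ} (hr : 0 ≤ r) :
    (phaseSpace d).IsHamiltonian r (ε * (r ^ (2 * p + 1) + 8 * d * r)) (F p ε) where
  holo z _ := (hasFDerivAt_F p ε z).differentiableAt.differentiableWithinAt
  bound z hz := by
    rw [(hasFDerivAt_F p ε z).fderiv]
    have hx : ‖z.fst‖ ≤ r := (norm_fst_le z).trans (mem_ball_zero_iff.1 hz).le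
    refine ContinuousLinearMap.opNorm_le_bound _ (by positivity) fun h => ?_
    refine ((derivF p ε z.fst).le_of_opNorm_le (norm_derivF_le p hε z.fst) _).trans ?_
    gcongr
    exact norm_fst_le h
  real z _ := F_conj p ε z

/-- For `R < 1` the nonlinear term is dominated by a linear one, which makes the bound uniform in
`p`. -/
theorem isHamiltonian_F_of_lt_one (p : ℕ) {ε : ℝ} (hε : 0 ≤ ε) {R : ℝ} (hR : 0 ≤ R)
    (hR1 : R < 1) : (phaseSpace d).IsHamiltonian R (ε * (8 * d + 1) * R) (F p ε) := by
  refine (isHamiltonian_F p hε hR).mono le_rfl ?_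
  have h1 : R ^ (2 * p + 1) ≤ R := pow_le_of_le_one hR hR1.le (by omega)
  nlinarith

theorem isHamiltonian_H (p : ℕ) {ε : ℝ} (hε : 0 ≤ ε) (r : ℝ) :
    ∃ M, (phaseSpace d).IsHamiltonian r M (H p ε) := by
  have h : H p ε = fun z => (phaseSpace d).energy z + F p ε z := by
    ext z
    rw [H, G_eq_energy]
  rw [h]
  exact ⟨_, (((phaseSpace d).isHamiltonian_energy |r|).add
    (isHamiltonian_F p hε (abs_nonneg r))).mono (le_abs_self r) le_rfl⟩

/-- At real points the interaction is bounded below by the energy of a single bond. -/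
theorem re_F_ge (hd : 1 ≤ d) (p : ℕ) {ε : ℝ} (hε : 0 ≤ ε) {z : Phase d} (hz : star z.fst = z.fst) :
    ε / 2 * ‖z.fst 0 - z.fst (0 + unitVec ⟨0, hd⟩)‖ ^ 2 ≤ (F p ε z).re := by
  have hb : ∀ k : Fin d → ℤ, bondEnergy k z.fst = ((‖diffSeq k z.fst‖ ^ 2 : ℝ) : ℂ) := fun k =>
    pair_self_of_real (by rw [← diffSeq_star, hz])
  -- The even power `2p + 2` is the square of the power `p + 1`, so every part of `F` is a
  -- nonnegative sum at real points.
  have hp : pair (powSeq (2 * p) z.fst) z.fst = ((‖powSeq p z.fst‖ ^ 2 : ℝ) : ℂ) := by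
    rw [← pair_self_of_real (by rw [← powSeq_star, hz]), pair_apply, pair_apply]
    refine tsum_congr fun j => ?_
    rw [powSeq_apply, powSeq_apply]
    ring
  have heq : F p ε z = ((ε / (2 * p + 2) * ‖powSeq p z.fst‖ ^ 2 + ε / 2 * ∑ i : Fin d,
      (‖diffSeq (unitVec i) z.fst‖ ^ 2 + ‖diffSeq (-unitVec i) z.fst‖ ^ 2) : ℝ) : ℂ) := by
    rw [F_eq, hp]
    simp only [hb]
    push_cast
    ring
  rw [heq, Complex.ofReal_re]
  have h1 : ‖diffSeq (unitVec ⟨0, hd⟩) z.fst‖ ^ 2 ≤ ∑ i : Fin d,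
      (‖diffSeq (unitVec i) z.fst‖ ^ 2 + ‖diffSeq (-unitVec i) z.fst‖ ^ 2) :=
    le_trans (by linarith [sq_nonneg ‖diffSeq (-unitVec ⟨0, hd⟩) z.fst‖])
      (Finset.single_le_sum (f := fun i : Fin d =>
        ‖diffSeq (unitVec i) z.fst‖ ^ 2 + ‖diffSeq (-unitVec i) z.fst‖ ^ 2)
        (fun i _ => by positivity) (Finset.mem_univ (⟨0, hd⟩ : Fin d)))
  have h2 : ‖z.fst 0 - z.fst (0 + unitVec ⟨0, hd⟩)‖ ^ 2
      ≤ ‖diffSeq (unitVec ⟨0, hd⟩) z.fst‖ ^ 2 :=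
    pow_le_pow_left₀ (norm_nonneg _) (norm_coord_le (diffSeq (unitVec ⟨0, hd⟩) z.fst) 0) 2
  have h3 := mul_le_mul_of_nonneg_left (h2.trans h1) (by positivity : 0 ≤ ε / 2)
  have h4 : 0 ≤ ε / (2 * p + 2) * ‖powSeq p z.fst‖ ^ 2 := by positivity
  linarith

/-- The point with a single excited site. -/
def singleSite (d : ℕ) (r : ℝ) : Phase d := WithLp.toLp 2 (lp.single 2 0 (r : ℂ), 0)

theorem singleSite_fst_zero (r : ℝ) : (singleSite d r).fst 0 = r := by
  simp [singleSite]

theorem singleSite_fst_of_ne (r : ℝ) {j : Fin d → ℤ} (hj : j ≠ 0) :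
    (singleSite d r).fst j = 0 := by
  simp [singleSite, hj]

theorem isReal_singleSite (r : ℝ) : IsReal (singleSite d r) := by
  intro j
  refine ⟨?_, by simp [momCoord, singleSite]⟩
  rcases eq_or_ne j 0 with rfl | hj
  · rw [posCoord, singleSite_fst_zero, Complex.ofReal_im]
  · rw [posCoord, singleSite_fst_of_ne r hj, Complex.zero_im]

theorem norm_singleSite {r : ℝ} (hr : 0 ≤ r) : ‖singleSite d r‖ = r := by
  have h : ‖singleSite d r‖ ^ 2 = r ^ 2 := by
    rw [norm_sq_phase]
    have h1 : ‖(singleSite d r).fst‖ = r := by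
      have := lp.norm_single (E := fun _ : Fin d → ℤ => ℂ) (p := 2) (by norm_num) 0 (r : ℂ)
      rw [Complex.norm_real, Real.norm_of_nonneg hr] at this
      exact this
    have h2 : (singleSite d r).snd = 0 := rfl
    rw [h1, h2, norm_zero]
    ring
  exact (sq_eq_sq₀ (norm_nonneg _) hr).1 h

instance : Nontrivial (Phase d) :=
  ⟨singleSite d 1, 0, fun h => by
    have := norm_singleSite (d := d) zero_le_one
    rw [h, norm_zero] at this
    norm_num at this⟩

/-- An a priori bound is needed because `toReal` sends an infinite supremum to 0. -/
theorem le_toReal_supNorm {R δ M : ℝ} {g : Phase d → ℂ} (hM : ∀ z ∈ ballRd d R δ, ‖g z‖ ≤ M)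
    {z : Phase d} (hz : z ∈ ballRd d R δ) : ‖g z‖ ≤ (supNorm R δ g).toReal := by
  have hfin : supNorm R δ g ≠ ⊤ := by
    refine ne_top_of_le_ne_top (ENNReal.ofReal_ne_top (r := M)) (iSup₂_le fun w hw => ?_)
    rw [← ofReal_norm]
    exact ENNReal.ofReal_le_ofReal (hM w hw)
  have h : ‖g z‖ₑ ≤ supNorm R δ g := le_iSup₂ (f := fun w (_ : w ∈ ballRd d R δ) => ‖g w‖ₑ) z hz
  simpa using ENNReal.toReal_mono hfin h

theorem _root_.HolomorphicNormalForm.OscillatorSpace.IsHamiltonian.exists_bound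
    {g : Phase d → ℂ} {R M : ℝ} (hg : (phaseSpace d).IsHamiltonian R M g) :
    ∃ B, ∀ z ∈ ballRd d R 0, ‖g z‖ ≤ B := by
  refine ⟨‖g 0‖ + M * R, fun z hz => ?_⟩
  rw [ballRd, sub_zero, mul_one] at hz
  have h0 : (0 : Phase d) ∈ ball 0 R := mem_ball_self (nonempty_ball.1 ⟨z, hz⟩)
  have h1 := hg.norm_sub_le h0 hz
  have hM : 0 ≤ M := (norm_nonneg _).trans (hg.bound z hz)
  have h2 : M * ‖z - 0‖ ≤ M * R := by
    rw [sub_zero]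
    have := (mem_ball_zero_iff.1 hz).le
    gcongr
  have h3 := norm_le_norm_add_norm_sub' (g z) (g 0)
  linarith

theorem le_supNorm_G {R : ℝ} (hR : 0 < R) :
    R ^ 2 / 8 ≤ (supNorm R 0 (G (d := d))).toReal := by
  obtain ⟨B, hB⟩ := ((phaseSpace d).isHamiltonian_energy R).exists_bound
  rw [← G_eq_energy] at hB
  have hz : singleSite d (R / 2) ∈ ballRd d R 0 := by
    rw [ballRd, mem_ball_zero_iff, norm_singleSite (by positivity)]
    linarith
  have h := le_toReal_supNorm hB hz
  rw [G_eq_energy, OscillatorSpace.energy_of_real ((conjL_eq_iff _).2 (isReal_singleSite _)),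
    norm_singleSite (by positivity), Complex.norm_real, Real.norm_of_nonneg (by positivity),
    ← G_eq_energy] at h
  linarith

/-- One excited site of height `R / 2` stretches a bond to a resting neighbour. The coupling term is
used, not the power term, so the bound does not depend on `p`; a bond exists since `d ≥ 1`. -/
theorem le_supNorm_F (hd : 1 ≤ d) (p : ℕ) {ε R : ℝ} (hε : 0 ≤ ε) (hR : 0 < R) :
    ε * R ^ 2 / 8 ≤ (supNorm R 0 (F (d := d) p ε)).toReal := by
  obtain ⟨B, hB⟩ := (isHamiltonian_F (d := d) p hε hR.le).exists_bound
  have hz : singleSite d (R / 2) ∈ ballRd d R 0 := by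
    rw [ballRd, mem_ball_zero_iff, norm_singleSite (by positivity)]
    linarith
  refine le_trans ?_ (le_toReal_supNorm hB hz)
  refine le_trans ?_ (Complex.re_le_norm _)
  have hreal : star (singleSite d (R / 2)).fst = (singleSite d (R / 2)).fst :=
    congrArg WithLp.fst ((conjL_eq_iff _).2 (isReal_singleSite (d := d) (R / 2)))
  have hne : (0 : Fin d → ℤ) + unitVec ⟨0, hd⟩ ≠ 0 := by
    rw [zero_add]
    intro h
    have := congrFun h ⟨0, hd⟩
    simp [unitVec] at this
  have h := re_F_ge hd p hε hreal
  rw [singleSite_fst_zero, singleSite_fst_of_ne _ hne, sub_zero, Complex.norm_real,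
    Real.norm_of_nonneg (by positivity)] at h
  linarith

end KleinGordon

/-! ### The normal form on explicit balls, and orbits in both time directions -/

namespace HolomorphicNormalForm

namespace OscillatorSpace

open Metric Filter Topology ComplexConjugate

variable {E : Type*} [NormedAddCommGroup E] [NormedSpace ℂ E] {S : OscillatorSpace E}

/-- A perturbation of size `κ` of the energy is in normal form, up to a remainder that is
exponentially small in the number `k` of averaging steps. -/
theorem exists_normalForm [CompleteSpace E] [Nontrivial E] {F : E → ℂ} {R δ κ : ℝ} {k : ℕ}
    (hR : 0 < R) (hκ : 0 < κ) (hκδ : 80 * κ < δ) (hk : k * (128 * κ) ≤ δ / 2)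
    (hF : S.IsHamiltonian R (κ * R) F) :
    ∃ (T m : E → E) (Z P : E → ℂ),
      S.NormalForm (fun z => S.energy z + F z) Z P T m (R * (1 - δ / 2)) (R * (1 - 2 * δ))
        (8 * κ * R) (2 * κ * R) (κ * R * 4⁻¹ ^ k) := by
  have hκR : 0 < κ * R := by positivity
  obtain ⟨T, Z, P, hT, -, hTn, hZ, hZA, hP, heq⟩ := exists_normal_form (k := k) hF hκR.le
    (s := 128 * (κ * R)) (by positivity) le_rfl
  have hρ : R * (1 - δ / 2) ≤ R - k * (128 * (κ * R)) := by
    have := mul_le_mul_of_nonneg_right hk hR.le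
    linarith
  have hq : (1 - 4⁻¹ ^ k : ℝ) ≤ 1 := by
    have : (0 : ℝ) ≤ 4⁻¹ ^ k := by positivity
    linarith
  have hle : ∀ {x : ℝ}, 0 ≤ x → x * (1 - 4⁻¹ ^ k) ≤ x := fun hx => mul_le_of_le_one_right hx hq
  have hsub := ball_subset_ball (x := (0 : E)) hρ
  have hnear : ∀ z ∈ ball 0 (R * (1 - δ / 2)), ‖T z - z‖ ≤ 8 * κ * R := fun z hz =>
    (hTn z (hsub hz)).trans ((hle (by positivity)).trans (by linarith))
  have hTd : DifferentiableOn ℂ T (ball 0 (R * (1 - δ / 2))) := hT.holo.mono hsub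
  have hδR : 80 * (κ * R) < δ * R := by nlinarith
  -- This `σ` takes the radius from `R(1 - δ/2)` down to `R(1 - 2δ)`.
  obtain ⟨m, hm, hmi, hmu⟩ := exists_inverse_near_id (σ := 3 / 2 * δ * R) (w := 8 * κ * R)
    (by nlinarith) (hTd.sub differentiableOn_id) hnear (by linarith)
  have hr : R * (1 - δ / 2) - 3 / 2 * δ * R = R * (1 - 2 * δ) := by ring
  have hsub' : ball (0 : E) (R * (1 - δ / 2) - 3 / 2 * δ * R / 2) ⊆ ball 0 (R * (1 - δ / 2)) :=
    ball_subset_ball (by linarith)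
  rw [hr] at hm hmi
  have hinv : ∀ z ∈ ball 0 (R * (1 - 2 * δ)), T (m z) = z := fun z hz => by
    have := (hmi z hz).2
    simpa using this
  refine ⟨T, m, Z, P, hT.mono hρ, hnear, hZ.mono hρ ((hle (by positivity)).trans (by linarith)),
    fun z hz => hZA z (hsub hz), hP.mono hρ le_rfl, fun z hz => heq z (hsub hz), hm,
    fun z hz => hsub' (hmi z hz).1, hinv, fun z hz => ?_⟩
  refine hmu _ (c_mem_ball (hmi z hz).1) _ ?_
  have h := hT.real _ (hsub (hsub' (hmi z hz).1))
  rw [hinv z hz] at h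
  simp [h]

namespace NormalForm

variable {H Z P : E → ℂ} {T m : E → E} {ρ ρm e b p : ℝ}

/-- The normalizing transformation is biholomorphic onto an open image. -/
theorem exists_biholomorphic [CompleteSpace E] [Nontrivial E]
    (N : S.NormalForm H Z P T m ρ ρm e b p) {σ : ℝ} (hσ : 0 < σ) (heσ : 8 * e ≤ σ) :
    IsOpen (T '' ball 0 (ρ - σ / 2)) ∧ ∃ U : E → E,
      DifferentiableOn ℂ U (T '' ball 0 (ρ - σ / 2)) ∧ LeftInvOn U T (ball 0 (ρ - σ / 2)) := by
  obtain ⟨Ψ, hΨs, hΨ, -, hΨd⟩ := exists_openPartialHomeomorph_near_id hσ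
    (N.sympl.holo.sub differentiableOn_id) N.near heσ
  have hΨT : (Ψ : E → E) = T := by
    ext z
    rw [hΨ]
    simp
  have himg : T '' ball 0 (ρ - σ / 2) = Ψ.target := by
    rw [← hΨT, ← hΨs, Ψ.image_source_eq_target]
  rw [himg]
  refine ⟨Ψ.open_target, Ψ.symm, hΨd, fun z hz => ?_⟩
  rw [← hΨT]
  exact Ψ.left_inv (hΨs ▸ hz)

variable [NormedSpace ℝ E] [IsScalarTower ℝ ℂ E]

/-- Stability in both directions of time. -/
theorem stability_two_sided (N : S.NormalForm H Z P T m ρ ρm e b p)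
    (hH : ∀ z, DifferentiableAt ℂ H z)
    {R δ κ τ : ℝ} (hR : 0 < R) (hδ : δ ≤ 1 / 4) (hκ : 0 ≤ κ) (hκδ : 80 * κ < δ)
    (hρ : ρ ≤ R) (hρm : ρm = R * (1 - 2 * δ)) (hρρ : ρm ≤ ρ) (he : e = 8 * κ * R)
    (hpρ : p * ρ * τ ≤ κ * R ^ 2) (hpb : p * b * τ ≤ 2 * κ ^ 2 * R ^ 2) (hb : b = 2 * κ * R)
    (hp : 0 ≤ p) {Y : E → E} (hY : ∀ z ∈ ball 0 ρm, Y z = S.J (fderiv ℂ H z))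
    (hYc : ∀ z, Y (S.c z) = S.c (Y z)) (hYL : ∀ r, ∃ K, LipschitzOnWith K Y (ball 0 r))
    {y : ℝ → E} (hy : ∀ t ∈ Icc (-τ) τ, HasDerivWithinAt y (Y (y t)) (Icc (-τ) τ) t)
    (hy0 : S.c (y 0) = y 0) (hy0R : ‖y 0‖ < R * (1 - 3 * δ)) {t : ℝ} (ht : |t| ≤ τ) :
    ‖y t‖ ≤ R * (1 - 5 / 2 * δ) ∧ ‖S.energy (y t) - S.energy (y 0)‖ ≤ 17 * κ * R ^ 2 ∧
      ‖Z (y t) - Z (y 0)‖ ≤ 34 * κ ^ 2 * R ^ 2 := by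
  have hτ : 0 ≤ τ := (abs_nonneg t).trans ht
  rcases le_total 0 t with h0 | h0
  · rw [abs_of_nonneg h0] at ht
    refine N.stability hH hR hδ hκ hκδ hρ hρm hρρ he hpρ hpb hb hp (σ := 1) (by simp)
      (Y := Y) (fun z hz => by rw [one_smul, hY z hz]) hYc hYL (fun s hs => ?_) hy0 hy0R t ⟨h0, ht⟩
    have hss : Icc 0 τ ⊆ Icc (-τ) τ := Icc_subset_Icc_left (by linarith)
    exact (hy s (hss hs)).mono hss
  · rw [abs_of_nonpos h0] at ht
    have h := N.stability hH hR hδ hκ hκδ hρ hρm hρρ he hpρ hpb hb hp (σ := -1) (by simp)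
      (Y := fun z => -Y z) (y := fun s => y (-s)) (τ := τ)
      (fun z hz => by rw [neg_one_smul, hY z hz])
      (fun z => by rw [hYc, map_neg])
      (fun r => (hYL r).imp fun K hK => LipschitzOnWith.of_dist_le_mul fun x hx z hz => by
        rw [dist_neg_neg]
        exact hK.dist_le_mul x hx z hz)
      (fun s hs => by
        have hss : MapsTo (fun s : ℝ => -s) (Icc 0 τ) (Icc (-τ) τ) := fun x hx =>
          ⟨by linarith [hx.2], by linarith [hx.1]⟩
        have := (hy (-s) (hss hs)).scomp s (hasDerivAt_neg s).hasDerivWithinAt hss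
        rw [neg_one_smul] at this
        exact this)
      (by simpa using hy0) (by simpa using hy0R) (-t) ⟨by linarith, ht⟩
    simpa using h

/-- Existence of the orbits over the time of stability. -/
theorem exists_orbit [CompleteSpace E] (N : S.NormalForm H Z P T m ρ ρm e b p)
    (hH : ∀ r, ∃ M, S.IsHamiltonian r M H)
    {R δ κ τ : ℝ} (hR : 0 < R) (hδ : δ ≤ 1 / 4) (hκ : 0 ≤ κ) (hκδ : 80 * κ < δ)
    (hρ : ρ ≤ R) (hρm : ρm = R * (1 - 2 * δ)) (hρρ : ρm ≤ ρ) (he : e = 8 * κ * R)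
    (hpρ : p * ρ * τ ≤ κ * R ^ 2) (hpb : p * b * τ ≤ 2 * κ ^ 2 * R ^ 2) (hb : b = 2 * κ * R)
    (hp : 0 ≤ p) (hτ : 0 ≤ τ) {z₀ : E} (hz₀ : S.c z₀ = z₀) (hz₀R : ‖z₀‖ < R * (1 - 3 * δ)) :
    ∃ y : ℝ → E, y 0 = z₀ ∧
      ∀ t ∈ Icc (-τ) τ, HasDerivWithinAt y (S.J (fderiv ℂ H (y t))) (Icc (-τ) τ) t := by
  -- The cutoff lives on radius `R + 1`; one more unit is spent by Cauchy's estimate for the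
  -- Lipschitz constant.
  obtain ⟨M, hM⟩ := hH (R + 1 + 1)
  have hM' := hM.mono (show R + 1 ≤ R + 1 + 1 by linarith) le_rfl
  have hM0 : 0 ≤ M :=
    (norm_nonneg _).trans (hM.bound 0 (mem_ball_self (by positivity)))
  have hX : ∀ z ∈ ball 0 (R + 1), ‖S.J (fderiv ℂ H z)‖ ≤ M := fun z hz => hM'.norm_field_le hz
  have hlip := lipschitzWith_cutoff hX hM0 hM.lipschitzOnWith_field
  obtain ⟨y, hy0, hy⟩ := exists_solution_of_lipschitzWith (L := M.toNNReal) hlip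
    (fun z => by rw [Real.coe_toNNReal _ hM0]; exact norm_cutoff_le hX hM0 z) hτ z₀
  have hHd : ∀ z, DifferentiableAt ℂ H z := fun z => by
    obtain ⟨M, hM⟩ := hH (‖z‖ + 1)
    exact hM.differentiableAt (mem_ball_zero_iff.2 (by linarith))
  have hXc : ∀ z, S.J (fderiv ℂ H (S.c z)) = S.c (S.J (fderiv ℂ H z)) := fun z => by
    obtain ⟨M, hM⟩ := hH (‖z‖ + 1)
    exact hM.field_conj (mem_ball_zero_iff.2 (by linarith))
  refine ⟨y, hy0, fun t ht => ?_⟩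
  -- The cutoff depends only on the norm, so the cut field commutes with conjugation and agrees with
  -- the true one on the ball of radius `R`; stability then keeps the orbit where the two coincide.
  have hbound := N.stability_two_sided hHd hR hδ hκ hκδ hρ hρm hρρ he hpρ hpb hb hp
    (fun z hz => cutoff_eq (X := fun z => S.J (fderiv ℂ H z))
      ((mem_ball_zero_iff.1 hz).le.trans (hρρ.trans hρ)))
    (fun z => by
      rw [cutoff, cutoff, S.norm_c, hXc, ← algebraMap_smul ℂ, ← algebraMap_smul ℂ (_ : ℝ)
        (S.J (fderiv ℂ H z)), map_smulₛₗ]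
      simp)
    (fun r => ⟨_, hlip.lipschitzOnWith⟩) hy (by rw [hy0, hz₀]) (by rwa [hy0]) (abs_le.2 ht)
  have h := hy t ht
  rwa [cutoff_eq (hbound.1.trans (by nlinarith))] at h

end NormalForm

end OscillatorSpace

end HolomorphicNormalForm

/-! ### Choice of constants and assembly -/

namespace KleinGordon

open Metric Filter Topology ComplexConjugate HolomorphicNormalForm

variable {d : ℕ}

/-- The number of averaging steps in terms of the size `κ` of the perturbation. -/
theorem exists_step_number {δ κ μ : ℝ} (hκ : 0 < κ) (hκδ : 1000 * κ < δ) (hμ : 512 * κ / δ ≤ μ) :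
    ∃ k : ℕ, k * (128 * κ) ≤ δ / 2 ∧ (4⁻¹ : ℝ) ^ k ≤ Real.exp (-(1 / μ)) := by
  have hδ : 0 < δ := by linarith
  -- This quotient is at least 2, so rounding down keeps more than half of it, and half of it is at
  -- least `1/μ`; each step gains `1/4 ≤ 1/e`.
  refine ⟨⌊δ / (256 * κ)⌋₊, ?_, ?_⟩
  · have h := Nat.floor_le (show 0 ≤ δ / (256 * κ) by positivity)
    rw [le_div_iff₀ (by positivity)] at h
    linarith
  · set k := ⌊δ / (256 * κ)⌋₊ with hk
    have h1 : δ / (256 * κ) < k + 1 := Nat.lt_floor_add_one _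
    have h2 : 2 ≤ δ / (256 * κ) := by
      rw [le_div_iff₀ (by positivity)]
      linarith
    have h3 : 1 / μ ≤ δ / (256 * κ) / 2 := by
      refine (one_div_le_one_div_of_le (by positivity) hμ).trans (le_of_eq ?_)
      field_simp
      norm_num
    have h4 : 1 / μ ≤ k := by linarith
    have h5 : (4⁻¹ : ℝ) ≤ Real.exp (-1) := by
      rw [Real.exp_neg]
      exact inv_anti₀ (Real.exp_pos 1) (by linarith [Real.exp_one_lt_d9])
    calc (4⁻¹ : ℝ) ^ k ≤ Real.exp (-1) ^ k := by gcongr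
      _ = Real.exp (-k) := by rw [← Real.exp_nat_mul]; congr 1; ring
      _ ≤ Real.exp (-(1 / μ)) := Real.exp_le_exp.2 (by linarith)

/-- With the constant `3K` the factor `24eπ` yields at least `24 · 8 · 3 = 576 ≥ 512`; the term `R ^
(2 * p)` only helps. -/
theorem le_mu {K R δ ε : ℝ} (p : ℕ) (hK : 0 ≤ K) (hR : 0 ≤ R) (hδ : 0 < δ) (hε : 0 ≤ ε) :
    512 * (ε * K) / δ ≤ mu (3 * K) R δ p ε := by
  rw [mu]
  refine div_le_div_of_nonneg_right ?_ hδ.le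
  have h1 : 8 ≤ Real.exp 1 * Real.pi := by
    have := mul_le_mul Real.exp_one_gt_d9.le Real.pi_gt_three.le (by norm_num) (Real.exp_pos 1).le
    linarith
  have h2 : ε * K ≤ ε * (3 * K + R ^ (2 * p)) / 3 := by
    have : 0 ≤ ε * R ^ (2 * p) := by positivity
    linarith
  have h3 : 0 ≤ ε * K := by positivity
  have h4 : 8 * (ε * (3 * K + R ^ (2 * p))) ≤
      Real.exp 1 * Real.pi * (ε * (3 * K + R ^ (2 * p))) :=
    mul_le_mul_of_nonneg_right h1 (by linarith)
  linarith

/-- A field bounded by the differential. -/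
theorem fieldNorm_le {R δ M B : ℝ} (hR : 0 < R) {g : Phase d → ℂ}
    (hg : ∀ z ∈ ballRd d R δ, ‖fderiv ℂ g z‖ ≤ M) (hM : M ≤ R * B) :
    fieldNorm R δ g ≤ ENNReal.ofReal B := by
  have h : ⨆ z ∈ ballRd d R δ, ‖hamField g z‖ₑ ≤ ENNReal.ofReal R * ENNReal.ofReal B := by
    rw [← ENNReal.ofReal_mul hR.le]
    refine iSup₂_le fun z hz => ?_
    rw [← ofReal_norm, hamField_eq, norm_hamVec]
    exact ENNReal.ofReal_le_ofReal ((hg z hz).trans hM)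
  have hR0 : ENNReal.ofReal R ≠ 0 := by simpa using hR
  refine (mul_le_mul_right h _).trans (le_of_eq ?_)
  rw [← mul_assoc, ENNReal.inv_mul_cancel hR0 ENNReal.ofReal_ne_top, one_mul]

theorem poisson_G_eq_zero {Z : Phase d → ℂ} {z : Phase d}
    (hZ : fderiv ℂ Z z ((phaseSpace d).A z) = 0) : poisson G Z z = 0 := by
  rw [poisson, G_eq_energy, (OscillatorSpace.hasFDerivAt_energy z).fderiv, hamField_eq,
    (phaseSpace d).ω_antisymm]
  have := (phaseSpace d).ω_J (fderiv ℂ Z z) ((phaseSpace d).A z)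
  rw [hZ] at this
  exact neg_eq_zero.2 this

theorem H_eq (p : ℕ) (ε : ℝ) :
    H (d := d) p ε = fun z => (phaseSpace d).energy z + F p ε z := by
  ext z
  rw [H, G_eq_energy]

section NormalForm

variable {H' Z P : Phase d → ℂ} {T m : Phase d → Phase d} {R δ e b q : ℝ}

theorem image_ballRd_subset
    (N : (phaseSpace d).NormalForm H' Z P T m (R * (1 - δ / 2)) (R * (1 - 2 * δ)) e b q)
    {η η' : ℝ} (hη : R * (1 - η) ≤ R * (1 - δ / 2)) (he : R * (1 - η) + e ≤ R * (1 - η')) :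
    T '' ballRd d R η ⊆ ballRd d R η' := by
  rintro _ ⟨z, hz, rfl⟩
  have h1 := mem_ball_zero_iff.1 hz
  have h2 := N.near z (ball_subset_ball hη hz)
  have h3 := norm_le_norm_add_norm_sub' (T z) z
  exact mem_ball_zero_iff.2 (by linarith)

theorem subset_image_ballRd
    (N : (phaseSpace d).NormalForm H' Z P T m (R * (1 - δ / 2)) (R * (1 - 2 * δ)) e b q)
    {η η' : ℝ} (hη : R * (1 - η) ≤ R * (1 - 2 * δ)) (he : R * (1 - η) + e ≤ R * (1 - η')) :
    ballRd d R η ⊆ T '' ballRd d R η' := by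
  intro z hz
  have hz' := ball_subset_ball hη hz
  have h1 := mem_ball_zero_iff.1 hz
  have h2 := N.norm_m_sub_le hz'
  have h3 := norm_le_norm_add_norm_sub' (m z) z
  exact ⟨m z, mem_ball_zero_iff.2 (by linarith), N.inv z hz'⟩

theorem isCanonical_of_normalForm
    (N : (phaseSpace d).NormalForm H' Z P T m (R * (1 - δ / 2)) (R * (1 - 2 * δ)) e b q)
    (hRδ : 0 < δ * R) (he : 8 * e ≤ δ * R) : IsCanonical T (ballRd d R δ) := by
  have hr : R * (1 - δ / 2) - δ * R / 2 = R * (1 - δ) := by ring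
  have hsub : ballRd d R δ ⊆ ball 0 (R * (1 - δ / 2)) := ball_subset_ball (by linarith)
  have h := N.exists_biholomorphic hRδ he
  rw [hr] at h
  refine ⟨N.sympl.holo.mono hsub, h.1, h.2, fun z hz h k => ?_, fun z hz hzr => ?_⟩
  · rw [sympl_eq, sympl_eq]
    exact N.sympl.sympl z (hsub hz) h k
  · have h := N.sympl.real z (hsub hz)
    have hc : (phaseSpace d).c z = z := (conjL_eq_iff z).2 hzr
    rw [hc] at h
    exact (conjL_eq_iff _).1 h.symm

end NormalForm

end KleinGordon

end

open KleinGordon HolomorphicNormalForm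

theorem theorem4 (d : ℕ) (hd : 1 ≤ d) :
    ∃ c : ℝ, 0 < c ∧ ∀ δ R : ℝ, 0 < δ → δ ≤ 1 / 4 → 0 < R → R < 1 →
      ∃ εstar C : ℝ, 0 < εstar ∧ 0 < C ∧
        ∀ p : ℕ, 1 ≤ p → ∀ ε : ℝ, 0 < ε → ε < εstar →
        ∀ μ : ℝ, μ = KleinGordon.mu c R δ p ε →
          ∃ (T : KleinGordon.Phase d → KleinGordon.Phase d) (Z P : KleinGordon.Phase d → ℂ),
            KleinGordon.IsCanonical T (KleinGordon.ballRd d R δ) ∧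
            (∀ z ∈ KleinGordon.ballRd d R δ, ‖T z - z‖ ≤ C * μ * R) ∧
            KleinGordon.ballRd d R (2 * δ) ⊆ T '' KleinGordon.ballRd d R δ ∧
            T '' KleinGordon.ballRd d R δ ⊆ KleinGordon.ballRd d R 0 ∧
            KleinGordon.ballRd d R (3 * δ) ⊆ T '' KleinGordon.ballRd d R (2 * δ) ∧
            T '' KleinGordon.ballRd d R (2 * δ) ⊆ KleinGordon.ballRd d R δ ∧
            DifferentiableOn ℂ Z (KleinGordon.ballRd d R δ) ∧
            DifferentiableOn ℂ P (KleinGordon.ballRd d R δ) ∧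
            (∀ z ∈ KleinGordon.ballRd d R δ, KleinGordon.IsReal z → (Z z).im = 0) ∧
            (∀ z ∈ KleinGordon.ballRd d R δ,
              KleinGordon.H p ε (T z) = KleinGordon.G z + Z z + P z) ∧
            (∀ z ∈ KleinGordon.ballRd d R δ, KleinGordon.poisson KleinGordon.G Z z = 0) ∧
            KleinGordon.fieldNorm R δ P ≤ ENNReal.ofReal (μ * Real.exp (-(1 / μ))) ∧
            ∀ z₀ ∈ KleinGordon.ballRd d R (3 * δ), KleinGordon.IsReal z₀ →
              (∃ z : ℝ → KleinGordon.Phase d,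
                KleinGordon.IsOrbit (KleinGordon.H p ε) (Real.exp (1 / μ)) z₀ z) ∧
              ∀ z : ℝ → KleinGordon.Phase d,
                KleinGordon.IsOrbit (KleinGordon.H p ε) (Real.exp (1 / μ)) z₀ z →
                ∀ t : ℝ, |t| ≤ Real.exp (1 / μ) →
                  z t ∈ KleinGordon.ballRd d R δ ∧
                  ‖KleinGordon.G (z t) - KleinGordon.G z₀‖
                    < C * μ * (KleinGordon.supNorm R 0 (KleinGordon.G (d := d))).toReal ∧
                  ‖Z (z t) - Z z₀‖
                    < C * μ * (KleinGordon.supNorm R 0 (KleinGordon.F (d := d) p ε)).toReal := by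
  have hK : (0 : ℝ) < 8 * d + 1 := by positivity
  have hK1 : (1 : ℝ) ≤ 8 * d + 1 := by linarith [(Nat.cast_nonneg d : (0 : ℝ) ≤ d)]
  obtain ⟨K, hKd⟩ : ∃ K : ℝ, K = 8 * d + 1 := ⟨_, rfl⟩
  rw [← hKd] at hK hK1
  -- The threshold ensures `1000κ < δ` for `κ = εK`. The factor `K` in `C` compensates for the lower
  -- bound of `F`, which is `εR²/8` and not `κR²/8`; the number 300 comes from `300/8 > 34`.
  refine ⟨3 * K, by positivity, fun δ R hδ hδ4 hR hR1 => ⟨δ / (1000 * K), 300 * K,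
    by positivity, by positivity, fun p _ ε hε hεs μ hμ => ?_⟩⟩
  obtain ⟨κ, hκd⟩ : ∃ κ : ℝ, κ = ε * K := ⟨_, rfl⟩
  have hκ : 0 < κ := by rw [hκd]; positivity
  have hκδ : 1000 * κ < δ := by
    rw [lt_div_iff₀ (by positivity)] at hεs
    rw [hκd]
    linarith
  have hμκ : 512 * κ / δ ≤ μ := by
    rw [hμ, hκd]
    exact le_mu p hK.le hR.le hδ hε.le
  have hκμ : κ ≤ μ := by
    refine le_trans ?_ hμκ
    rw [le_div_iff₀ hδ]
    nlinarith
  have hμ0 : 0 < μ := hκ.trans_le hκμ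
  obtain ⟨k, hk, hkμ⟩ := exists_step_number hκ hκδ hμκ
  have hF : (phaseSpace d).IsHamiltonian R (κ * R) (F p ε) := by
    rw [hκd, hKd]
    exact isHamiltonian_F_of_lt_one p hε.le hR.le hR1
  have hκδ' : 80 * κ < δ := by linarith
  obtain ⟨T, m, Z, P, N⟩ := OscillatorSpace.exists_normalForm hR hκ hκδ' hk hF
  rw [← H_eq] at N
  obtain ⟨q, hq⟩ : ∃ q : ℝ, q = 4⁻¹ ^ k := ⟨_, rfl⟩
  have hq0 : 0 < q := by rw [hq]; positivity
  rw [← hq] at N hkμ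
  have hδR : 0 < δ * R := by positivity
  have hκR : 80 * (κ * R) < δ * R := by nlinarith
  have hsub : ballRd d R δ ⊆ Metric.ball 0 (R * (1 - δ / 2)) :=
    Metric.ball_subset_ball (by linarith)
  have hτ : 0 < Real.exp (1 / μ) := Real.exp_pos _
  -- The length of the time interval is balanced against the smallness of the remainder.
  have hqτ : q * Real.exp (1 / μ) ≤ 1 := by
    refine (mul_le_mul_of_nonneg_right hkμ hτ.le).trans (le_of_eq ?_)
    rw [← Real.exp_add, neg_add_cancel, Real.exp_zero]
  have hκq : κ * q ≤ μ * Real.exp (-(1 / μ)) := mul_le_mul hκμ hkμ hq0.le hμ0.le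
  have hρ : R * (1 - δ / 2) ≤ R := by linarith
  have hρρ : R * (1 - 2 * δ) ≤ R * (1 - δ / 2) := by linarith
  have hpρ : κ * R * q * (R * (1 - δ / 2)) * Real.exp (1 / μ) ≤ κ * R ^ 2 := by
    calc _ = κ * R * (R * (1 - δ / 2)) * (q * Real.exp (1 / μ)) := by ring
      _ ≤ κ * R * R * 1 := by
        have : 0 ≤ R * (1 - δ / 2) := by nlinarith
        gcongr
      _ = _ := by ring
  have hpb : κ * R * q * (2 * κ * R) * Real.exp (1 / μ) ≤ 2 * κ ^ 2 * R ^ 2 := by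
    calc _ = 2 * κ ^ 2 * R ^ 2 * (q * Real.exp (1 / μ)) := by ring
      _ ≤ 2 * κ ^ 2 * R ^ 2 * 1 := by gcongr
      _ = _ := by ring
  have hp0 : 0 ≤ κ * R * q := by positivity
  have hH := isHamiltonian_H (d := d) p hε.le
  have hHd : ∀ z, DifferentiableAt ℂ (H (d := d) p ε) z := fun z => by
    obtain ⟨M, hM⟩ := hH (‖z‖ + 1)
    exact hM.differentiableAt (mem_ball_zero_iff.2 (by linarith))
  have hXc : ∀ z, hamField (H p ε) ((phaseSpace d).c z) =
      (phaseSpace d).c (hamField (H p ε) z) := fun z => by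
    obtain ⟨M, hM⟩ := hH (‖z‖ + 1)
    exact hM.field_conj (mem_ball_zero_iff.2 (by linarith))
  refine ⟨T, Z, P, isCanonical_of_normalForm N hδR (by linarith), fun z hz => ?_,
    subset_image_ballRd N le_rfl (by linarith), image_ballRd_subset N (by linarith) (by linarith),
    subset_image_ballRd N (by linarith) (by linarith),
    image_ballRd_subset N (by linarith) (by linarith), N.hZ.holo.mono hsub, N.hP.holo.mono hsub,
    fun z hz hzr => ?_, fun z hz => ?_, fun z hz => poisson_G_eq_zero (N.hZA z (hsub hz)),
    fieldNorm_le hR (fun z hz => N.hP.bound z (hsub hz)) ?_, fun z₀ hz₀ hz₀r => ?_⟩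
  · refine (N.near z (hsub hz)).trans (mul_le_mul_of_nonneg_right ?_ hR.le)
    nlinarith
  · have h := N.hZ.real z (hsub hz)
    rw [show (phaseSpace d).c z = z from (conjL_eq_iff z).2 hzr] at h
    exact Complex.conj_eq_iff_im.1 h.symm
  · rw [N.eq z (hsub hz), G_eq_energy]
  · nlinarith
  · have hz₀c : (phaseSpace d).c z₀ = z₀ := (conjL_eq_iff z₀).2 hz₀r
    have hz₀R := mem_ball_zero_iff.1 hz₀
    refine ⟨N.exists_orbit hH hR hδ4 hκ.le hκδ' hρ rfl hρρ rfl hpρ hpb rfl hp0 hτ.le hz₀c hz₀R,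
      fun z hz t ht => ?_⟩
    obtain ⟨hz0, hzt⟩ := hz
    have h := N.stability_two_sided hHd hR hδ4 hκ.le hκδ' hρ rfl hρρ rfl hpρ hpb rfl hp0
      (fun z _ => rfl) hXc (fun r => by
        obtain ⟨M, hM⟩ := hH (r + 1)
        exact ⟨_, hM.lipschitzOnWith_field⟩) hzt (by rw [hz0, hz₀c]) (by rwa [hz0]) ht
    rw [hz0] at h
    refine ⟨mem_ball_zero_iff.2 (h.1.trans_lt (by linarith)), ?_, ?_⟩
    · rw [G_eq_energy]
      refine h.2.1.trans_lt ?_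
      rw [← G_eq_energy]
      calc 17 * κ * R ^ 2 < 300 * K * μ * (R ^ 2 / 8) := by
            have h1 : κ * R ^ 2 ≤ K * μ * R ^ 2 := by
              have : κ ≤ K * μ := by nlinarith
              gcongr
            have h2 : 0 < κ * R ^ 2 := by positivity
            linarith
        _ ≤ _ := mul_le_mul_of_nonneg_left (le_supNorm_G hR) (by positivity)
    · refine h.2.2.trans_lt ?_
      calc 34 * κ ^ 2 * R ^ 2 < 300 * K * μ * (ε * R ^ 2 / 8) := by
            have h1 : κ * (κ * R ^ 2) ≤ μ * (κ * R ^ 2) := by gcongr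
            have h2 : 0 < κ * (κ * R ^ 2) := by positivity
            have h3 : 300 * K * μ * (ε * R ^ 2 / 8) = 300 / 8 * (μ * (κ * R ^ 2)) := by
              rw [hκd]
              ring
            rw [h3]
            linarith
        _ ≤ _ := mul_le_mul_of_nonneg_left (le_supNorm_F hd p hε.le hR) (by positivity)
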